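/- **Setting.** Let $\mathcal X\subseteq\mathbb R^{N_1}$ be nonempty, convex and compact, $c:\mathcal X\to\mathbb R$ convex, $\mathcal Y\subseteq\mathbb R^{N_2}$ a closed, convex, pointed, full-dimensional cone with dual cone $\mathcal Y^*$, and let $\Xi=\{\xi\in\{0,1\}^M: E\xi\le f\}$ with $E\in\mathbb R^{F\times M}$, $f\in\mathbb R^F$. Let $q(\xi)=q_0+Q\xi\in\mathbb R^{N_2}$ and $W(\xi)=W_0+\sum_{j=1}^M\xi_jW_j\in\mathbb R^{L\times N_2}$, and let $T:\mathcal X\to\mathbb R^{L\times M}$, $h:\mathcal X\to\mathbb R^L$ be componentwise convex and lower semicontinuous. The second-stage loss is $$\mathcal Q(x,\xi)=\inf_{y\in\mathcal Y}\{q(\xi)^\top y: W(\xi)y\ge T(x)\xi+h(x)\}.$$ Assume (A1) for every $\xi\in\Xi$ there is $y^+\in\operatorname{int}\mathcal Y$ with $W(\xi)y^+>0$; (A2) $\mathcal Q(x,\xi)$ is finite for all $x\in\mathcal X$, $\xi\in\Xi$. Let $\mathbb P$ be a probability distribution on $\Xi$, let $\hat\xi^{(1)},\hat\xi^{(2)},\dots$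 be i.i.d. with law $\mathbb P$, let $\hat{\mathbb P}_N=\frac1N\sum_{i\le N}\delta_{\hat\xi^{(i)}}$, let $\|\cdot\|$ be a norm on $\mathbb R^M$, and let $d_W$ be the Wasserstein distance $d_W(\mathbb Q,\mathbb Q')=\min_\Pi\sum_{\xi,\xi'\in\Xi}\|\xi-\xi'\|\,\Pi(\xi,\xi')$ over couplings $\Pi$ of $\mathbb Q,\mathbb Q'$. For radii $\varepsilon_N\ge0$ define the optimal value of the distributionally robust (DRO) problem $$v^\star_N=\inf_{x\in\mathcal X}\Big\{c(x)+\sup\{\mathbb E_{\mathbb Q}[\mathcal Q(x,\xi)]:\ \mathbb Q\text{ a distribution on }\Xi,\ d_W(\mathbb Q,\hat{\mathbb P}_N)\le\varepsilon_N\}\Big\}$$ and the optimal value of the true two-stage stochastic problem $v_\infty=\inf_{x\in\mathcal X}\{c(x)+\mathbb E_{\mathbb P}[\mathcal Q(x,\xi)]\}$. The DRO problem has convex hull reformulations $\inf_{x\in\mathcal X,\alpha\ge0}c(x)+\alpha\varepsilon_N+\frac1N\sum_{i\le N}\sup_{z\in\operatorname{cl\,conv}\mathcal Z_i}\{g(x,z)-\alpha\tau\}$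 with mixed-integer conic sets $\mathcal Z_i$. Replacing $\operatorname{cl\,conv}\mathcal Z_i$ by the continuous relaxation $\mathcal Z_i^0$ of $\mathcal Z_i$ gives $$v^0_N=\inf_{x\in\mathcal X,\ \alpha\ge0}\ c(x)+\alpha\varepsilon_N+\frac1N\sum_{i=1}^N\ \sup_{z\in\mathcal Z_i^0}\{g(x,z)-\alpha\tau\}.$$ With $\Xi^0=\{\xi\in[0,1]^M:E\xi\le f\}$, the two representations are: * *Linearized.* Let $\bar\lambda\in\mathbb R^L_+$ be such that $\lambda\le\bar\lambda$ whenever $\lambda\ge0$ and $q(\xi)-W(\xi)^\top\lambda\in\mathcal Y^*$ for some $\xi\in\Xi$. Then $z=(\xi,\lambda,\Lambda,\tau)$, $g(x,z)=\langle T(x),\Lambda\rangle+h(x)^\top\lambda$, and $\mathcal Z_i^0$ is the set of $z\in\Xi^0\times\mathbb R^L_+\times\mathbb R^{L\times M}_+\times\mathbb R_+$ with $\|\xi-\hat\xi^{(i)}\|\le\tau$, $\lambda_l-\bar\lambda_l(1-\xi_j)\le\Lambda_{lj}\le\min\{\lambda_l,\bar\lambda_l\xi_j\}$ for all $l,j$,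 and $q_0+Q\xi-W_0^\top\lambda-\sum_jW_j^\top\Lambda e_j\in\mathcal Y^*$. * *Penalty*, under fixed recourse: (A3) $W(\xi)=W_0$ on $\Xi$ and $T(x)=T_0$ on $\mathcal X$. Let $\rho>0$ be an exact penalty parameter, i.e. for all $x\in\mathcal X$, $\xi\in\Xi$, $\mathcal Q(x,\xi)$ equals $\inf_{y\in\mathcal Y,\,\zeta\in[0,1]^M}\{q(\xi)^\top y+\rho((e-2\xi)^\top\zeta+e^\top\xi):W_0y\ge T_0\zeta+h(x)\}$, where $e$ is the all-ones vector. Then $z=(\xi,\lambda,\mu,\tau)$, $g(x,z)=h(x)^\top\lambda+\rho\,e^\top\xi-e^\top\mu$, and $\mathcal Z_i^0$ is the set of $z\in\Xi^0\times\mathbb R^L_+\times\mathbb R^M_+\times\mathbb R_+$ with $\|\xi-\hat\xi^{(i)}\|\le\tau$, $q_0+Q\xi-W_0^\top\lambda\in\mathcal Y^*$ and $\rho(e-2\xi)+T_0^\top\lambda+\mu\ge0$. In both cases $\mathcal Z_i$ is the same set with $\Xi$ in place of $\Xi^0$. **Theorem.** Suppose $N\varepsilon_N\to0$ as $N\to\infty$.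 Then $v_\infty$ is finite and, almost surely, $\lim_{N\to\infty}v^\star_N=v_\infty$. Moreover, bounds $\bar\lambda$ as above exist, and for every such $\bar\lambda$ the value $v^0_N$ of the linearized representation satisfies $\lim_{N\to\infty}v^0_N=v_\infty=\lim_{N\to\infty}v_N^\star$ almost surely. Under (A3), every sufficiently large $\rho$ is an exact penalty parameter, and for every exact $\rho>0$ the value $v^0_N$ of the penalty representation likewise satisfies $\lim_{N\to\infty}v^0_N=v_\infty=\lim_{N\to\infty}v_N^\star$ almost surely. -/

import Mathlib

open Filter Topology MeasureTheory ProbabilityTheory Matrix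

noncomputable section

/-- Data of a two-stage conic problem with zero-one uncertainty, with first-stage decisions
`x ∈ X ⊆ ℝ^{N₁}`, second-stage decisions `y ∈ Y ⊆ ℝ^{N₂}`, `L` second-stage constraints,
`M` uncertain parameters and an outer description of the support by `F` linear inequalities. -/
structure TwoStageProblem (N₁ N₂ L M F : ℕ) where
  /-- first-stage feasible set -/
  X : Set (Fin N₁ → ℝ)
  X_nonempty : X.Nonempty
  X_convex : Convex ℝ X
  X_compact : IsCompact X
  /-- first-stage cost -/
  c : (Fin N₁ → ℝ) → ℝ
  c_convex : ConvexOn ℝ X c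
  /-- second-stage cone: closed, convex, pointed and full-dimensional -/
  Y : ProperCone ℝ (Fin N₂ → ℝ)
  Y_pointed : ∀ y, y ∈ Y → -y ∈ Y → y = 0
  Y_solid : (interior (Y : Set (Fin N₂ → ℝ))).Nonempty
  /-- `q(ξ) = q₀ + Qmat ξ` -/
  q₀ : Fin N₂ → ℝ
  Qmat : Matrix (Fin N₂) (Fin M) ℝ
  /-- `W(ξ) = W₀ + ∑ j, ξ_j W_j` -/
  W₀ : Matrix (Fin L) (Fin N₂) ℝ
  W : Fin M → Matrix (Fin L) (Fin N₂) ℝ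
  /-- `T` and `h` are componentwise convex and closed (lower semicontinuous) on `X` -/
  T : (Fin N₁ → ℝ) → Matrix (Fin L) (Fin M) ℝ
  T_convex : ∀ l j, ConvexOn ℝ X (fun x => T x l j)
  T_closed : ∀ l j, LowerSemicontinuousOn (fun x => T x l j) X
  h : (Fin N₁ → ℝ) → Fin L → ℝ
  h_convex : ∀ l, ConvexOn ℝ X (fun x => h x l)
  h_closed : ∀ l, LowerSemicontinuousOn (fun x => h x l) X
  /-- outer description `E ξ ≤ f` of the support -/
  E : Matrix (Fin F) (Fin M) ℝ
  f : Fin F → ℝ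
  /-- an arbitrary norm on `ℝ^M`, inducing the metric on the support -/
  nrm : Seminorm ℝ (Fin M → ℝ)
  nrm_definite : ∀ v, nrm v = 0 → v = 0

namespace TwoStageProblem

variable {N₁ N₂ L M F : ℕ} (D : TwoStageProblem N₁ N₂ L M F)

/-- The support `Ξ = {ξ ∈ {0,1}^M : E ξ ≤ f}`. -/
def Xi : Finset (Fin M → ℝ) :=
  (Fintype.piFinset fun _ : Fin M => ({0, 1} : Finset ℝ)).filter fun ξ => ∀ k, (D.E *ᵥ ξ) k ≤ D.f k

/-- The continuous relaxation `{ξ ∈ [0,1]^M : E ξ ≤ f}` of the support. -/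
def XiRelaxed : Set (Fin M → ℝ) :=
  {ξ | (∀ j, 0 ≤ ξ j ∧ ξ j ≤ 1) ∧ ∀ k, (D.E *ᵥ ξ) k ≤ D.f k}

/-- The affine cost vector `q(ξ)`. -/
def qAt (ξ : Fin M → ℝ) : Fin N₂ → ℝ := D.q₀ + D.Qmat *ᵥ ξ

/-- The affine recourse matrix `W(ξ)`. -/
def WAt (ξ : Fin M → ℝ) : Matrix (Fin L) (Fin N₂) ℝ := D.W₀ + ∑ j, ξ j • D.W j

/-- The dual cone `Y*`. -/
def dualCone : Set (Fin N₂ → ℝ) := {w | ∀ y ∈ D.Y, 0 ≤ w ⬝ᵥ y}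

/-- The second-stage loss `Q(x, ξ)`, as an extended real. -/
def loss (x : Fin N₁ → ℝ) (ξ : Fin M → ℝ) : EReal :=
  ⨅ y ∈ {y : Fin N₂ → ℝ | y ∈ D.Y ∧ D.T x *ᵥ ξ + D.h x ≤ D.WAt ξ *ᵥ y},
    ((D.qAt ξ ⬝ᵥ y : ℝ) : EReal)

/-- Complete recourse. -/
def CompleteRecourse : Prop :=
  ∀ ξ ∈ D.Xi, ∃ y ∈ interior (D.Y : Set (Fin N₂ → ℝ)), ∀ l, 0 < (D.WAt ξ *ᵥ y) l

/-- Sufficiently expensive recourse: the loss is a finite number. -/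
def ExpensiveRecourse : Prop :=
  ∀ x ∈ D.X, ∀ ξ ∈ D.Xi, D.loss x ξ ≠ ⊥ ∧ D.loss x ξ ≠ ⊤

/-- Fixed recourse: `W(ξ) = W₀` on the support and `T(x) = T₀` on `X`. -/
def FixedRecourse (T₀ : Matrix (Fin L) (Fin M) ℝ) : Prop :=
  (∀ ξ ∈ D.Xi, D.WAt ξ = D.W₀) ∧ ∀ x ∈ D.X, D.T x = T₀

/-! ### Two-stage stochastic and distributionally robust problems

Distributions on the finite support are weight vectors in the standard simplex `stdSimplex ℝ D.Xi`. -/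

/-- The expectation of the loss `Q(x, ·)` (finite by sufficiently expensive recourse). -/
def expectedLoss (x : Fin N₁ → ℝ) (p : D.Xi → ℝ) : ℝ := ∑ ξ, p ξ * (D.loss x ξ).toReal

/-- Optimal value of the two-stage stochastic problem under the distribution `P`. -/
def stochasticValue (P : D.Xi → ℝ) : EReal :=
  ⨅ x ∈ D.X, ((D.c x + D.expectedLoss x P : ℝ) : EReal)

/-- The empirical distribution `(1/N) ∑ i, δ_{s i}` of a sample. -/
def empirical {N : ℕ} (s : Fin N → D.Xi) : D.Xi → ℝ :=
  fun ξ => (1 / (N : ℝ)) * ∑ i, if s i = ξ then 1 else 0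

/-- Couplings of two distributions on the support. -/
def IsCoupling (p p' : D.Xi → ℝ) (γ : D.Xi → D.Xi → ℝ) : Prop :=
  (∀ ξ ξ', 0 ≤ γ ξ ξ') ∧ (∀ ξ, ∑ ξ', γ ξ ξ' = p ξ) ∧ ∀ ξ', ∑ ξ, γ ξ ξ' = p' ξ'

/-- The Wasserstein distance for the metric `d(ξ, ξ') = ‖ξ - ξ'‖`. -/
def wasserstein (p p' : D.Xi → ℝ) : ℝ :=
  sInf {t | ∃ γ, D.IsCoupling p p' γ ∧
    t = ∑ ξ : D.Xi, ∑ ξ' : D.Xi, D.nrm ((ξ : Fin M → ℝ) - ξ') * γ ξ ξ'}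

/-- The Wasserstein ambiguity set of radius `ε` around the empirical distribution. -/
def ambiguitySet {N : ℕ} (ε : ℝ) (s : Fin N → D.Xi) : Set (D.Xi → ℝ) :=
  {p | p ∈ stdSimplex ℝ D.Xi ∧ D.wasserstein p (D.empirical s) ≤ ε}

/-- Optimal value of the distributionally robust two-stage problem. -/
def droValue {N : ℕ} (ε : ℝ) (s : Fin N → D.Xi) : EReal :=
  ⨅ x ∈ D.X, ((D.c x : EReal) + ⨆ p ∈ D.ambiguitySet ε s, (D.expectedLoss x p : EReal))

/-! ### The convex hull reformulation over a given family of sets -/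

/-- The optimal value of
`inf_{x ∈ X, α ≥ 0} c(x) + α ε + (1/N) ∑ i, sup_{z ∈ S i} (g x z - α τ(z))`, that is, of the convex
hull reformulation in which the `i`-th inner maximization ranges over `S i`. -/
def reformValue {V : Type*} (g : (Fin N₁ → ℝ) → V → ℝ) (τ : V → ℝ) {N : ℕ} (ε : ℝ)
    (S : Fin N → Set V) : EReal :=
  ⨅ x ∈ D.X, ⨅ α ∈ Set.Ici (0 : ℝ), (((D.c x + α * ε : ℝ) : EReal) +
    ((1 / (N : ℝ) : ℝ) : EReal) * ∑ i, ⨆ z ∈ S i, ((g x z - α * τ z : ℝ) : EReal))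

/-! ### Linearized representation -/

/-- `lamBar` bounds all dual variables: `0 ≤ lamBar`, and every `λ ≥ 0` with
`q(ξ) - W(ξ)ᵀ λ ∈ Y*` for some `ξ` in the support satisfies `λ ≤ lamBar`. -/
def IsDualBound (lamBar : Fin L → ℝ) : Prop :=
  0 ≤ lamBar ∧ ∀ ξ ∈ D.Xi, ∀ lam : Fin L → ℝ, 0 ≤ lam →
    D.qAt ξ - (D.WAt ξ)ᵀ *ᵥ lam ∈ D.dualCone → lam ≤ lamBar

/-- The linearized set in the variables `(ξ, λ, Λ, τ)` with `ξ` ranging over `S`: for `S = Ξ` it is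
the mixed-integer conic set `𝒵_i`, for `S = XiRelaxed` it is its continuous relaxation. -/
def linearizedSet (S : Set (Fin M → ℝ)) (lamBar : Fin L → ℝ) (ξhat : Fin M → ℝ) :
    Set ((Fin M → ℝ) × (Fin L → ℝ) × Matrix (Fin L) (Fin M) ℝ × ℝ) :=
  {z | match z with
    | (ξ, lam, Lam, τ) =>
      ξ ∈ S ∧ 0 ≤ lam ∧ (∀ l j, 0 ≤ Lam l j) ∧ 0 ≤ τ ∧ D.nrm (ξ - ξhat) ≤ τ ∧
      (∀ l j, 0 ≤ Lam l j - lam l + lamBar l * (1 - ξ j)) ∧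
      (∀ l j, 0 ≤ lam l - Lam l j) ∧
      (∀ l j, 0 ≤ lamBar l * ξ j - Lam l j) ∧
      D.q₀ + D.Qmat *ᵥ ξ - D.W₀ᵀ *ᵥ lam - ∑ j, (D.W j)ᵀ *ᵥ (fun l => Lam l j) ∈ D.dualCone}

/-- The objective `⟨T(x), Λ⟩ + h(x)ᵀ λ`. -/
def linearizedObjective (x : Fin N₁ → ℝ)
    (z : (Fin M → ℝ) × (Fin L → ℝ) × Matrix (Fin L) (Fin M) ℝ × ℝ) : ℝ :=
  (∑ l, ∑ j, D.T x l j * z.2.2.1 l j) + D.h x ⬝ᵥ z.2.1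

/-- Optimal value of the convex hull reformulation with each hull replaced by the continuous
relaxation of the linearized set. -/
def linearizedRelaxedValue (lamBar : Fin L → ℝ) {N : ℕ} (ε : ℝ) (s : Fin N → D.Xi) : EReal :=
  D.reformValue D.linearizedObjective (fun z => z.2.2.2) ε
    fun i => D.linearizedSet D.XiRelaxed lamBar (s i)

/-! ### Penalty representation (under fixed recourse) -/

/-- The penalized loss `Q^ρ(x, ξ)`. -/
def penaltyLoss (T₀ : Matrix (Fin L) (Fin M) ℝ) (ρ : ℝ) (x : Fin N₁ → ℝ) (ξ : Fin M → ℝ) :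
    EReal :=
  ⨅ yz ∈ {yz : (Fin N₂ → ℝ) × (Fin M → ℝ) | yz.1 ∈ D.Y ∧ (∀ j, 0 ≤ yz.2 j ∧ yz.2 j ≤ 1) ∧
      T₀ *ᵥ yz.2 + D.h x ≤ D.W₀ *ᵥ yz.1},
    ((D.qAt ξ ⬝ᵥ yz.1 + ρ * (∑ j, (1 - 2 * ξ j) * yz.2 j + ∑ j, ξ j) : ℝ) : EReal)

/-- `ρ` is an exact penalty parameter: `Q^ρ = Q` on `X × Ξ`. -/
def IsExactPenalty (T₀ : Matrix (Fin L) (Fin M) ℝ) (ρ : ℝ) : Prop :=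
  ∀ x ∈ D.X, ∀ ξ ∈ D.Xi, D.penaltyLoss T₀ ρ x ξ = D.loss x ξ

/-- The penalty set in the variables `(ξ, λ, μ, τ)` with `ξ` ranging over `S`: for `S = Ξ` it is the
mixed-integer conic set `𝒵_i`, for `S = XiRelaxed` it is its continuous relaxation. -/
def penaltySet (S : Set (Fin M → ℝ)) (T₀ : Matrix (Fin L) (Fin M) ℝ) (ρ : ℝ)
    (ξhat : Fin M → ℝ) : Set ((Fin M → ℝ) × (Fin L → ℝ) × (Fin M → ℝ) × ℝ) :=
  {z | match z with
    | (ξ, lam, mu, τ) =>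
      ξ ∈ S ∧ 0 ≤ lam ∧ 0 ≤ mu ∧ 0 ≤ τ ∧ D.nrm (ξ - ξhat) ≤ τ ∧
      D.q₀ + D.Qmat *ᵥ ξ - D.W₀ᵀ *ᵥ lam ∈ D.dualCone ∧
      ∀ j, 0 ≤ ρ * (1 - 2 * ξ j) + (T₀ᵀ *ᵥ lam) j + mu j}

/-- The objective `h(x)ᵀ λ + ρ eᵀ ξ - eᵀ μ`. -/
def penaltyObjective (ρ : ℝ) (x : Fin N₁ → ℝ)
    (z : (Fin M → ℝ) × (Fin L → ℝ) × (Fin M → ℝ) × ℝ) : ℝ :=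
  D.h x ⬝ᵥ z.2.1 + ρ * ∑ j, z.1 j - ∑ j, z.2.2.1 j

/-- Optimal value of the convex hull reformulation with each hull replaced by the continuous
relaxation of the penalty set. -/
def penaltyRelaxedValue (T₀ : Matrix (Fin L) (Fin M) ℝ) (ρ : ℝ) {N : ℕ} (ε : ℝ)
    (s : Fin N → D.Xi) : EReal :=
  D.reformValue (D.penaltyObjective ρ) (fun z => z.2.2.2) ε
    fun i => D.penaltySet D.XiRelaxed T₀ ρ (s i)

end TwoStageProblem

end

/-! All three sequences are squeezed between sample average quantities. From below, each dominates
the sample average value: the empirical law lies in the Wasserstein ball, and each relaxed set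
contains, at the sample point and with `τ = 0`, a point built from an optimal second-stage dual
multiplier, on which the slope `α` costs nothing. From above, fix `x`. With `ξ` held at the binary
sample point, the relaxed constraints still reproduce an exact dual, so weak duality bounds the
objective by the loss. Elsewhere the objective may exceed the loss, but after reduction to a compact
set a large slope absorbs the excess up to `δ` (`IsCompact.exists_penalty_slope`). The support is
finite, so one slope serves every `N` and every sample, at a price `α * ε N` that vanishes; a
Lipschitz constant of the loss plays this role for the Wasserstein ball. The radii matter only
through `ε N → 0`.

It remains to compare sample average and true values (`tendsto_of_sampleAverage_bounds`). The upper
half fixes a nearly optimal `x`. The lower half must be uniform in `x`, without an upper bound on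
the losses over `X`: costs are uniformly bounded below (`exists_cost_lower_bound`), and on a finite
support the empirical weights eventually dominate `(1 - δ) P`, which suffices. The only
probabilistic input is the almost sure convergence of empirical frequencies. -/

/-! ### Preliminaries from convex analysis and compactness -/

/-- Lagrangian duality: under Slater's condition, a lower bound of a convex program is certified by
nonnegative multipliers. -/
theorem exists_lagrange_multiplier {E : Type*} [AddCommGroup E] [Module ℝ E] {L : ℕ} {C : Set E}
    (hC : Convex ℝ C) {φ : E → ℝ} (hφ : ConvexOn ℝ C φ) {G : E → Fin L → ℝ}
    (hG : ∀ l, ConcaveOn ℝ C fun u => G u l) {v : ℝ} (hv : ∀ u ∈ C, 0 ≤ G u → v ≤ φ u)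
    {u₀ : E} (hu₀ : u₀ ∈ C) (hslater : ∀ l, 0 < G u₀ l) :
    ∃ lam : Fin L → ℝ, 0 ≤ lam ∧ ∀ u ∈ C, v ≤ φ u - lam ⬝ᵥ G u := by
  -- Strict inequalities make this set of dominated constraint levels and exceeded costs open
  -- without any continuity of `φ` or `G`. It misses `(0, v)`, and the separating functional gives
  -- the multipliers.
  let S : Set ((Fin L → ℝ) × ℝ) := ⋃ u ∈ C, {p | (∀ l, p.1 l < G u l) ∧ φ u < p.2}
  have hSo : IsOpen S := by
    refine isOpen_biUnion fun u _ => ?_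
    refine IsOpen.and ?_ (isOpen_lt continuous_const continuous_snd)
    simp only [Set.ofPred_forall]
    exact isOpen_iInter_of_finite fun l => isOpen_lt (by fun_prop) continuous_const
  have hSc : Convex ℝ S := by
    rintro p hp p' hp' a b ha hb hab
    simp only [S, Set.mem_iUnion, Set.mem_ofPred_eq, exists_prop] at hp hp' ⊢
    obtain ⟨u, hu, h1, h2⟩ := hp
    obtain ⟨u', hu', h1', h2'⟩ := hp'
    have key : ∀ {s t s' t' : ℝ}, s < t → s' < t' → a * s + b * s' < a * t + b * t' := by
      intro s t s' t' h h'
      rcases eq_or_lt_of_le ha with rfl | ha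
      · have : b = 1 := by linarith
        subst this; linarith
      · have := mul_lt_mul_of_pos_left h ha
        have := mul_le_mul_of_nonneg_left h'.le hb
        linarith
    refine ⟨a • u + b • u', hC hu hu' ha hb hab, fun l => ?_, ?_⟩
    · have := (hG l).2 hu hu' ha hb hab
      simp only [smul_eq_mul] at this
      simpa using (key (h1 l) (h1' l)).trans_le this
    · have := hφ.2 hu hu' ha hb hab
      simp only [smul_eq_mul] at this
      simpa using this.trans_lt (key h2 h2')
  have hp : ((0 : Fin L → ℝ), v) ∉ S := by
    simp only [S, Set.mem_iUnion, Set.mem_ofPred_eq, exists_prop, not_exists, not_and, not_lt]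
    intro u hu h
    exact hv u hu fun l => (h l).le
  obtain ⟨f, hf⟩ := geometric_hahn_banach_open_point hSc hSo hp
  let a : Fin L → ℝ := fun l => f (Pi.single l 1, 0)
  let b : ℝ := f (0, 1)
  have hfab : ∀ w r, f (w, r) = a ⬝ᵥ w + b * r := by
    intro w r
    have h1 : (w, r) = ∑ l, w l • ((Pi.single l 1 : Fin L → ℝ), (0 : ℝ)) + r • (0, 1) := by
      refine Prod.ext ?_ ?_
      · funext l
        simp [Prod.fst_sum, Finset.sum_apply, Pi.single_apply]
      · simp [Prod.snd_sum]
    rw [h1, map_add, map_sum]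
    simp only [map_smul, smul_eq_mul, a, b, dotProduct, mul_comm]
  have hmem : ∀ u ∈ C, ∀ w r, (∀ l, w l < G u l) → φ u < r → a ⬝ᵥ w + b * r < b * v := by
    intro u hu w r hw hr
    have := hf (w, r) (by
      simp only [S, Set.mem_iUnion, Set.mem_ofPred_eq, exists_prop]
      exact ⟨u, hu, hw, hr⟩)
    rw [hfab, hfab] at this
    simpa using this
  have hlim : ∀ u ∈ C, ∀ w r, (∀ l, w l ≤ G u l) → φ u ≤ r → a ⬝ᵥ w + b * r ≤ b * v := by
    intro u hu w r hw hr
    have ht : Tendsto (fun t : ℝ => a ⬝ᵥ (fun l => w l - t) + b * (r + t)) (𝓝[>] 0)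
        (𝓝 (a ⬝ᵥ (fun l => w l - 0) + b * (r + 0))) := by
      refine tendsto_nhdsWithin_of_tendsto_nhds (Continuous.tendsto ?_ 0)
      simp only [dotProduct]
      fun_prop
    simp only [sub_zero, add_zero] at ht
    refine le_of_tendsto ht ?_
    filter_upwards [self_mem_nhdsWithin] with t ht
    have ht' : (0 : ℝ) < t := ht
    exact (hmem u hu _ _ (fun l => by linarith [hw l]) (by linarith)).le
  -- Slater's point rules out a vertical separating hyperplane: it puts `(0, r)` in `S` for some `r
  -- > v`.
  have hb : b < 0 := by
    have h1 := hmem u₀ hu₀ 0 (max (φ u₀) v + 1) hslater (by linarith [le_max_left (φ u₀) v])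
    simp only [dotProduct_zero, zero_add] at h1
    by_contra hb
    have := mul_le_mul_of_nonneg_left
      (show v ≤ max (φ u₀) v + 1 by linarith [le_max_right (φ u₀) v]) (not_lt.1 hb)
    linarith
  -- `S` is unbounded in the direction of decreasing `w l`, so a negative coefficient would violate
  -- the separation.
  have ha : ∀ l, 0 ≤ a l := by
    intro l
    by_contra! hl
    have h1 : ∀ t : ℝ, 0 ≤ t → -(t * a l) + b * φ u₀ ≤ b * v := by
      intro t ht
      have := hlim u₀ hu₀ (-(t • Pi.single l 1)) (φ u₀) (fun k => by
        by_cases hk : k = l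
        · subst hk; simp; linarith [hslater k]
        · simp [hk]; exact (hslater k).le) le_rfl
      simpa using this
    have h2 := h1 ((|b * v - b * φ u₀| + 1) / (-a l)) (by
      have : 0 < -a l := by linarith
      positivity)
    have h3 : -((|b * v - b * φ u₀| + 1) / (-a l) * a l) = |b * v - b * φ u₀| + 1 := by
      have := hl.ne
      field_simp
    rw [h3] at h2
    linarith [le_abs_self (b * v - b * φ u₀)]
  refine ⟨fun l => a l / (-b), fun l => div_nonneg (ha l) (by linarith), fun u hu => ?_⟩
  have h1 := hlim u hu (G u) (φ u) (fun _ => le_rfl) le_rfl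
  have h2 : (fun l => a l / (-b)) ⬝ᵥ G u = (a ⬝ᵥ G u) / (-b) := by
    simp only [dotProduct, Finset.sum_div]
    exact Finset.sum_congr rfl fun l _ => by ring
  have h4 : (a ⬝ᵥ G u) / (-b) ≤ φ u - v := by
    rw [div_le_iff₀ (by linarith)]
    nlinarith
  rw [h2]
  linarith

/-- A convex function on a compact convex set in finite dimension is bounded below; no
semicontinuity is required. -/
theorem ConvexOn.exists_lower_bound {n : ℕ} {X : Set (Fin n → ℝ)} {c : (Fin n → ℝ) → ℝ}
    (hc : ConvexOn ℝ X c) (hX : IsCompact X) : ∃ B, ∀ x ∈ X, B ≤ c x := by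
  rcases X.eq_empty_or_nonempty with rfl | ⟨x₀, hx₀⟩
  · exact ⟨0, by simp⟩
  -- At height one, linear independence is affine independence: a maximal independent family in
  -- `lift '' X` gives points of `X` in which every `x ∈ X` has affine coordinates summing to one.
  let lift : (Fin n → ℝ) → (Fin n → ℝ) × ℝ := fun x => (x, 1)
  obtain ⟨t, htX, hspan, hli⟩ := exists_linearIndependent ℝ (lift '' X)
  have : Finite t := hli.finite
  have := Fintype.ofFinite t
  let β := Module.Basis.span hli
  have hrange : Submodule.span ℝ (Set.range ((↑) : t → (Fin n → ℝ) × ℝ)) =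
      Submodule.span ℝ (lift '' X) := by rw [Subtype.range_coe, hspan]
  have hmem : ∀ x ∈ X, lift x ∈ Submodule.span ℝ (Set.range ((↑) : t → (Fin n → ℝ) × ℝ)) := by
    intro x hx
    rw [hrange]
    exact Submodule.subset_span ⟨x, hx, rfl⟩
  choose pt hptX hpt using fun i : t => htX i.2
  obtain ⟨A, hA0, hA⟩ : ∃ A > 0, ∀ x (hx : x ∈ X), ∀ i, |β.repr ⟨lift x, hmem x hx⟩ i| ≤ A := by
    have hcont : Continuous fun w : Submodule.span ℝ (Set.range ((↑) : t → (Fin n → ℝ) × ℝ)) =>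
        ∑ i, |β.repr w i| := by
      refine continuous_finsetSum _ fun i _ => Continuous.abs ?_
      exact (β.coord i).continuous_of_finiteDimensional
    have hK : IsCompact ((↑) ⁻¹' (lift '' X) :
        Set (Submodule.span ℝ (Set.range ((↑) : t → (Fin n → ℝ) × ℝ)))) := by
      refine (Submodule.closed_of_finiteDimensional _).isClosedEmbedding_subtypeVal.isCompact_preimage
        (hX.image ?_)
      fun_prop
    obtain ⟨A, hA⟩ := hK.bddAbove_image hcont.continuousOn
    refine ⟨max A 1, by positivity, fun x hx i => ?_⟩
    refine le_trans ?_ (le_max_left A 1)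
    refine le_trans ?_ (hA ⟨⟨lift x, hmem x hx⟩, ⟨x, hx, rfl⟩, rfl⟩)
    exact Finset.single_le_sum (f := fun i => |β.repr ⟨lift x, hmem x hx⟩ i|)
      (fun _ _ => abs_nonneg _) (Finset.mem_univ i)
  have hexp : ∀ x (hx : x ∈ X), ∑ i, β.repr ⟨lift x, hmem x hx⟩ i • pt i = x ∧
      ∑ i, β.repr ⟨lift x, hmem x hx⟩ i = 1 := by
    intro x hx
    have h1 := congrArg Subtype.val (β.sum_repr ⟨lift x, hmem x hx⟩)
    have h2 : ∀ i, ((β i : Submodule.span ℝ (Set.range ((↑) : t → (Fin n → ℝ) × ℝ))) :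
        (Fin n → ℝ) × ℝ) = (pt i, 1) := by
      intro i
      rw [Module.Basis.span_apply]
      exact (hpt i).symm
    simp only [Submodule.coe_sum, Submodule.coe_smul, h2] at h1
    constructor
    · simpa [Prod.fst_sum] using congrArg Prod.fst h1
    · simpa [Prod.snd_sum] using congrArg Prod.snd h1
  have hne : Nonempty t := by
    by_contra hempty
    rw [not_nonempty_iff] at hempty
    simpa using (hexp x₀ hx₀).2
  let k : ℝ := Fintype.card t
  have hk : 0 < k := by simp only [k]; exact_mod_cast Fintype.card_pos
  -- Small enough that `1 / k - s * a i ≥ 0` for all coordinates `a` bounded by `A`. The barycentre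
  -- `b` is then a convex combination of `x`, with fixed weight `s > 0`, and the points `pt i`;
  -- Jensen's inequality at `b` is solved for `c x`.
  let s : ℝ := 1 / (2 * k * A + 1)
  have hs : 0 < s := by positivity
  have hs1 : s < 1 := by
    simp only [s]
    rw [div_lt_one (by positivity)]
    have := mul_pos hk hA0
    linarith
  have hsA : s * A ≤ 1 / k := by
    simp only [s]
    rw [div_mul_eq_mul_div, div_le_div_iff₀ (by positivity) hk]
    nlinarith [mul_pos hk hA0]
  let b : Fin n → ℝ := ∑ i, (1 / k) • pt i
  refine ⟨(c b - (1 / k + s * A) * ∑ i, |c (pt i)|) / s, fun x hx => ?_⟩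
  obtain ⟨h1, h2⟩ := hexp x hx
  set a := fun i => β.repr ⟨lift x, hmem x hx⟩ i with ha
  have hab := hA x hx
  have hw0 : ∀ i, 0 ≤ 1 / k - s * a i := by
    intro i
    have := mul_le_mul_of_nonneg_left ((le_abs_self _).trans (hab i)) hs.le
    linarith
  have hw1 : ∑ o : Option t, (Option.elim o s fun i => 1 / k - s * a i) = 1 := by
    rw [Fintype.sum_option]
    simp only [Option.elim]
    rw [Finset.sum_sub_distrib, ← Finset.mul_sum, h2]
    simp only [Finset.sum_const, Finset.card_univ, nsmul_eq_mul]
    change s + (k * (1 / k) - s * 1) = 1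
    field_simp
    ring
  have hj := hc.map_sum_le (t := Finset.univ)
    (w := fun o : Option t => Option.elim o s fun i => 1 / k - s * a i)
    (p := fun o : Option t => Option.elim o x pt)
    (by rintro (_ | i) - <;> [exact hs.le; exact hw0 i]) hw1
    (by rintro (_ | i) - <;> [exact hx; exact hptX i])
  have hb : ∑ o : Option t, (Option.elim o s fun i => 1 / k - s * a i) •
      (Option.elim o x pt : Fin n → ℝ) = b := by
    rw [Fintype.sum_option]
    simp only [Option.elim, sub_smul, Finset.sum_sub_distrib, mul_smul, ← Finset.smul_sum]
    rw [h1]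
    simp [b, Finset.smul_sum]
  rw [hb, Fintype.sum_option] at hj
  simp only [Option.elim, smul_eq_mul] at hj
  have hsum : ∑ i, (1 / k - s * a i) * c (pt i) ≤ (1 / k + s * A) * ∑ i, |c (pt i)| := by
    rw [Finset.mul_sum]
    refine Finset.sum_le_sum fun i _ => ?_
    calc (1 / k - s * a i) * c (pt i) ≤ (1 / k - s * a i) * |c (pt i)| :=
          mul_le_mul_of_nonneg_left (le_abs_self _) (hw0 i)
      _ ≤ _ := by
          refine mul_le_mul_of_nonneg_right ?_ (abs_nonneg _)
          have := mul_le_mul_of_nonneg_left ((neg_abs_le _).trans' (neg_le_neg (hab i))) hs.le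
          linarith
  rw [div_le_iff₀ hs]
  linarith

/-- On a compact set, a penalty that vanishes only where `g ≤ q` can be scaled so that the penalized
function is at most `q + δ`. -/
theorem IsCompact.exists_penalty_slope {V : Type*} [TopologicalSpace V] {K : Set V}
    (hK : IsCompact K) {g d : V → ℝ} (hg : ContinuousOn g K) (hd : ContinuousOn d K)
    (hd0 : ∀ z ∈ K, 0 ≤ d z) {q : ℝ} (hq : ∀ z ∈ K, d z = 0 → g z ≤ q) {δ : ℝ} (hδ : 0 < δ) :
    ∃ α ≥ 0, ∀ z ∈ K, g z - α * d z ≤ q + δ := by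
  obtain ⟨B, hB⟩ := hK.bddAbove_image hg
  have hB : ∀ z ∈ K, g z ≤ B := fun z hz => hB ⟨z, hz, rfl⟩
  -- On the part of `K` where `g ≥ q + δ` the penalty `d` cannot vanish, so its minimum there is
  -- positive; the slope divides the largest possible excess by that minimum.
  have hK' : IsCompact (K ∩ g ⁻¹' Set.Ici (q + δ)) := by
    obtain ⟨u, hu, hu'⟩ := continuousOn_iff_isClosed.1 hg _ isClosed_Ici
    rw [Set.inter_comm, hu', Set.inter_comm]
    exact hK.inter_right hu
  rcases (K ∩ g ⁻¹' Set.Ici (q + δ)).eq_empty_or_nonempty with he | hne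
  · refine ⟨0, le_rfl, fun z hz => ?_⟩
    by_contra! h
    have : z ∈ K ∩ g ⁻¹' Set.Ici (q + δ) := ⟨hz, by simpa using h.le⟩
    simp [he] at this
  · obtain ⟨z₀, hz₀, hmin⟩ := hK'.exists_isMinOn hne (hd.mono Set.inter_subset_left)
    have hz₀g : q + δ ≤ g z₀ := hz₀.2
    have hpos : 0 < d z₀ := by
      refine lt_of_le_of_ne (hd0 _ hz₀.1) fun h => ?_
      linarith [hq z₀ hz₀.1 h.symm]
    have hBq : 0 ≤ B - q := by linarith [hB z₀ hz₀.1]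
    refine ⟨(B - q) / d z₀, by positivity, fun z hz => ?_⟩
    by_cases h : q + δ ≤ g z
    · have h1 : d z₀ ≤ d z := hmin ⟨hz, h⟩
      have h2 : B - q ≤ (B - q) / d z₀ * d z := by
        rw [div_mul_eq_mul_div, le_div_iff₀ hpos]
        exact mul_le_mul_of_nonneg_left h1 hBq
      linarith [hB z hz]
    · have : 0 ≤ (B - q) / d z₀ * d z := mul_nonneg (by positivity) (hd0 z hz)
      linarith

/-! ### Duality and bounds for the second-stage problem -/

namespace TwoStageProblem

variable {N₁ N₂ L M F : ℕ} {D : TwoStageProblem N₁ N₂ L M F}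

theorem mem_Xi {ξ : Fin M → ℝ} :
    ξ ∈ D.Xi ↔ (∀ j, ξ j = 0 ∨ ξ j = 1) ∧ ∀ k, (D.E *ᵥ ξ) k ≤ D.f k := by
  simp [Xi, Fintype.mem_piFinset]

theorem nonneg_of_mem_Xi {ξ : Fin M → ℝ} (hξ : ξ ∈ D.Xi) (j : Fin M) : 0 ≤ ξ j := by
  rcases (mem_Xi.1 hξ).1 j with h | h <;> simp [h]

theorem mem_XiRelaxed_of_mem_Xi {ξ : Fin M → ℝ} (hξ : ξ ∈ D.Xi) : ξ ∈ D.XiRelaxed := by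
  refine ⟨fun j => ?_, (mem_Xi.1 hξ).2⟩
  rcases (mem_Xi.1 hξ).1 j with h | h <;> simp [h]

theorem dotProduct_transpose_mulVec {m n : ℕ} (A : Matrix (Fin m) (Fin n) ℝ) (v : Fin m → ℝ)
    (y : Fin n → ℝ) : (Aᵀ *ᵥ v) ⬝ᵥ y = v ⬝ᵥ (A *ᵥ y) := by
  rw [mulVec_transpose, dotProduct_mulVec]

theorem sub_mem_dualCone_iff {q : Fin N₂ → ℝ} {A : Matrix (Fin L) (Fin N₂) ℝ} {lam : Fin L → ℝ} :
    q - Aᵀ *ᵥ lam ∈ D.dualCone ↔ ∀ y ∈ D.Y, lam ⬝ᵥ (A *ᵥ y) ≤ q ⬝ᵥ y := by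
  simp only [dualCone, Set.mem_ofPred_eq, sub_dotProduct, dotProduct_transpose_mulVec, sub_nonneg]

theorem coe_toReal_loss (hA2 : D.ExpensiveRecourse) {x : Fin N₁ → ℝ} (hx : x ∈ D.X)
    {ξ : Fin M → ℝ} (hξ : ξ ∈ D.Xi) : ((D.loss x ξ).toReal : EReal) = D.loss x ξ :=
  EReal.coe_toReal (hA2 x hx ξ hξ).2 (hA2 x hx ξ hξ).1

/-- Weak duality for the second-stage problem. -/
theorem dual_le_loss {x : Fin N₁ → ℝ} {ξ : Fin M → ℝ} {lam : Fin L → ℝ} (hlam : 0 ≤ lam)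
    (hdual : D.qAt ξ - (D.WAt ξ)ᵀ *ᵥ lam ∈ D.dualCone) :
    ((lam ⬝ᵥ (D.T x *ᵥ ξ + D.h x) : ℝ) : EReal) ≤ D.loss x ξ := by
  refine le_iInf₂ fun y hy => ?_
  obtain ⟨hyY, hy⟩ := hy
  exact EReal.coe_le_coe_iff.2 ((dotProduct_le_dotProduct_of_nonneg_left hy hlam).trans
    (sub_mem_dualCone_iff.1 hdual y hyY))

/-- A linear functional that is bounded below on the cone belongs to the dual cone. -/
theorem mem_dualCone_of_bounded_below {w : Fin N₂ → ℝ} {r : ℝ} (h : ∀ y ∈ D.Y, r ≤ w ⬝ᵥ y) :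
    w ∈ D.dualCone := by
  intro y hy
  by_contra! hneg
  -- The scaling brings the functional to `-(|r| + 1)`, which is below `r`.
  have h1 := h (((|r| + 1) / (-(w ⬝ᵥ y))) • y) (D.Y.smul_mem hy (by
    have : 0 < -(w ⬝ᵥ y) := by linarith
    positivity))
  rw [dotProduct_smul, smul_eq_mul] at h1
  have h2 : (|r| + 1) / (-(w ⬝ᵥ y)) * (w ⬝ᵥ y) = -(|r| + 1) := by
    have := hneg.ne
    field_simp
  linarith [neg_abs_le r]

theorem Y_convex : Convex ℝ (D.Y : Set (Fin N₂ → ℝ)) := by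
  intro y hy y' hy' a b ha hb _
  exact D.Y.add_mem (D.Y.smul_mem hy ha) (D.Y.smul_mem hy' hb)

/-- A recourse matrix that is strictly positive somewhere on the cone reaches every level strictly. -/
theorem exists_strictly_feasible {A : Matrix (Fin L) (Fin N₂) ℝ}
    (hA : ∃ y ∈ D.Y, ∀ l, 0 < (A *ᵥ y) l) (b : Fin L → ℝ) :
    ∃ y ∈ D.Y, ∀ l, b l < (A *ᵥ y) l := by
  obtain ⟨y, hy, hpos⟩ := hA
  have h0 : ∀ l, 0 ≤ |b l| / (A *ᵥ y) l := fun l => div_nonneg (abs_nonneg _) (hpos l).le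
  have ht : 0 ≤ ∑ l, |b l| / (A *ᵥ y) l + 1 := by
    have := Finset.sum_nonneg fun l (_ : l ∈ Finset.univ) => h0 l
    linarith
  refine ⟨(∑ l, |b l| / (A *ᵥ y) l + 1) • y, D.Y.smul_mem hy ht, fun l => ?_⟩
  rw [mulVec_smul, Pi.smul_apply, smul_eq_mul]
  have h1 := Finset.single_le_sum (fun l _ => h0 l) (Finset.mem_univ l)
  have h2 : |b l| = |b l| / (A *ᵥ y) l * (A *ᵥ y) l := by
    have := (hpos l).ne'
    field_simp
  nlinarith [le_abs_self (b l), hpos l]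

theorem CompleteRecourse.exists_pos (hA1 : D.CompleteRecourse) {ξ : Fin M → ℝ} (hξ : ξ ∈ D.Xi) :
    ∃ y ∈ D.Y, ∀ l, 0 < (D.WAt ξ *ᵥ y) l := by
  obtain ⟨y, hy, h⟩ := hA1 ξ hξ
  exact ⟨y, interior_subset hy, h⟩

/-- Strong duality for the second-stage problem, with an attained dual. -/
theorem exists_dual_optimal (hA1 : D.CompleteRecourse) (hA2 : D.ExpensiveRecourse)
    {x : Fin N₁ → ℝ} (hx : x ∈ D.X) {ξ : Fin M → ℝ} (hξ : ξ ∈ D.Xi) :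
    ∃ lam : Fin L → ℝ, 0 ≤ lam ∧ D.qAt ξ - (D.WAt ξ)ᵀ *ᵥ lam ∈ D.dualCone ∧
      (D.loss x ξ).toReal ≤ lam ⬝ᵥ (D.T x *ᵥ ξ + D.h x) := by
  obtain ⟨y₀, hy₀, hs⟩ := exists_strictly_feasible (hA1.exists_pos hξ) (D.T x *ᵥ ξ + D.h x)
  obtain ⟨lam, hlam, h⟩ := exists_lagrange_multiplier (D.Y_convex) (φ := fun y => D.qAt ξ ⬝ᵥ y)
    (G := fun y => D.WAt ξ *ᵥ y - (D.T x *ᵥ ξ + D.h x)) (v := (D.loss x ξ).toReal)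
    ⟨D.Y_convex, fun y _ y' _ a b _ _ _ => by simp [dotProduct_add, dotProduct_smul]⟩
    (fun l => ⟨D.Y_convex, fun y _ y' _ a b _ _ hab => by
      simp only [mulVec_add, mulVec_smul, Pi.sub_apply, Pi.add_apply, Pi.smul_apply, smul_eq_mul]
      have : b = 1 - a := by linarith
      subst this
      apply le_of_eq
      ring⟩)
    (fun y hy hG => by
      rw [← EReal.coe_le_coe_iff, coe_toReal_loss hA2 hx hξ]
      exact iInf₂_le y ⟨hy, sub_nonneg.1 hG⟩)
    hy₀ (fun l => sub_pos.2 (hs l))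
  -- The Lagrangian bound is a constant lower bound for a linear functional on the cone. Boundedness
  -- gives dual feasibility, and `y = 0` gives the value.
  have h' : ∀ y ∈ D.Y, (D.loss x ξ).toReal - lam ⬝ᵥ (D.T x *ᵥ ξ + D.h x) ≤
      (D.qAt ξ - (D.WAt ξ)ᵀ *ᵥ lam) ⬝ᵥ y := by
    intro y hy
    have := h y hy
    rw [dotProduct_sub] at this
    rw [sub_dotProduct, dotProduct_transpose_mulVec]
    linarith
  refine ⟨lam, hlam, mem_dualCone_of_bounded_below h', ?_⟩
  simpa using h' 0 D.Y.zero_mem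

/-- Complete recourse bounds the dual variables. -/
theorem exists_isDualBound (hA1 : D.CompleteRecourse) : ∃ lamBar, D.IsDualBound lamBar := by
  have h : ∀ ξ : D.Xi, ∃ y ∈ D.Y, ∀ l, 0 < (D.WAt ξ *ᵥ y) l := fun ξ => hA1.exists_pos ξ.2
  choose y hy hpos using h
  have h0 : ∀ l (ξ : D.Xi), 0 ≤ |D.qAt ξ ⬝ᵥ y ξ| / (D.WAt ξ *ᵥ y ξ) l :=
    fun l ξ => div_nonneg (abs_nonneg _) (hpos ξ l).le
  -- Pairing the dual constraint with `y ξ` bounds a sum of nonnegative terms `lam l * (D.WAt ξ *ᵥ y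
  -- ξ) l`, hence each term. Summing over the finite support removes the dependence on `ξ`.
  refine ⟨fun l => ∑ ξ : D.Xi, |D.qAt ξ ⬝ᵥ y ξ| / (D.WAt ξ *ᵥ y ξ) l,
    fun l => Finset.sum_nonneg fun ξ _ => h0 l ξ, fun ξ hξ lam hlam hdual l => ?_⟩
  refine le_trans ?_ (Finset.single_le_sum (fun ξ _ => h0 l ξ) (Finset.mem_univ (⟨ξ, hξ⟩ : D.Xi)))
  rw [le_div_iff₀ (hpos ⟨ξ, hξ⟩ l)]
  refine le_trans ?_ (le_abs_self _)
  refine le_trans ?_ (sub_mem_dualCone_iff.1 hdual (y ⟨ξ, hξ⟩) (hy ⟨ξ, hξ⟩))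
  exact Finset.single_le_sum (f := fun l => lam l * (D.WAt ξ *ᵥ y ⟨ξ, hξ⟩) l)
    (fun k _ => mul_nonneg (hlam k) (hpos ⟨ξ, hξ⟩ k).le) (Finset.mem_univ l)

/-- The total cost is bounded below on the first-stage feasible set. -/
theorem exists_cost_lower_bound (hA1 : D.CompleteRecourse) (hA2 : D.ExpensiveRecourse) :
    ∃ C, ∀ x ∈ D.X, ∀ ξ : D.Xi, C ≤ D.c x + (D.loss x ξ).toReal := by
  obtain ⟨Bc, hBc⟩ := D.c_convex.exists_lower_bound D.X_compact
  choose BT hBT using fun l j => (D.T_convex l j).exists_lower_bound D.X_compact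
  choose Bh hBh using fun l => (D.h_convex l).exists_lower_bound D.X_compact
  obtain ⟨x₀, hx₀⟩ := D.X_nonempty
  -- Dual feasibility does not involve `x`, so multipliers found at the single point `x₀` bound the
  -- loss from below at every `x`.
  choose lam hlam hdual _ using fun ξ : D.Xi => exists_dual_optimal hA1 hA2 hx₀ ξ.2
  let r : D.Xi → ℝ := fun ξ => lam ξ ⬝ᵥ ((BT : Matrix (Fin L) (Fin M) ℝ) *ᵥ ξ + Bh)
  have hr : ∀ x ∈ D.X, ∀ ξ : D.Xi, r ξ ≤ (D.loss x ξ).toReal := by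
    intro x hx ξ
    rw [← EReal.coe_le_coe_iff, coe_toReal_loss hA2 hx ξ.2]
    refine le_trans ?_ (dual_le_loss (hlam ξ) (hdual ξ))
    refine EReal.coe_le_coe_iff.2 (dotProduct_le_dotProduct_of_nonneg_left (fun l => ?_) (hlam ξ))
    refine add_le_add ?_ (hBh l x hx)
    simp only [mulVec, dotProduct]
    refine Finset.sum_le_sum fun j _ => ?_
    exact mul_le_mul_of_nonneg_right (hBT l j x hx) (nonneg_of_mem_Xi ξ.2 j)
  refine ⟨Bc - ∑ ξ, |r ξ|, fun x hx ξ => ?_⟩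
  have h1 := Finset.single_le_sum (fun ξ _ => abs_nonneg (r ξ)) (Finset.mem_univ ξ)
  linarith [hBc x hx, hr x hx ξ, neg_abs_le (r ξ)]

/-! ### Empirical distributions and stability of the stochastic value -/

theorem empirical_mem_stdSimplex {N : ℕ} (hN : N ≠ 0) (s : Fin N → D.Xi) :
    D.empirical s ∈ stdSimplex ℝ D.Xi := by
  refine ⟨fun ξ => ?_, ?_⟩
  · refine mul_nonneg (by positivity) (Finset.sum_nonneg fun i _ => ?_)
    split_ifs <;> norm_num
  · simp only [empirical, ← Finset.mul_sum]
    rw [Finset.sum_comm]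
    simp [hN]

theorem expectedLoss_empirical {N : ℕ} (s : Fin N → D.Xi) (x : Fin N₁ → ℝ) :
    D.expectedLoss x (D.empirical s) = (1 / (N : ℝ)) * ∑ i, (D.loss x (s i)).toReal := by
  simp only [expectedLoss, empirical, mul_assoc, ← Finset.mul_sum, Finset.sum_mul]
  rw [Finset.sum_comm]
  simp

theorem exists_stochasticValue_eq_coe {P : D.Xi → ℝ} (hP : P ∈ stdSimplex ℝ D.Xi)
    (hA1 : D.CompleteRecourse) (hA2 : D.ExpensiveRecourse) :
    ∃ v : ℝ, D.stochasticValue P = (v : EReal) := by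
  obtain ⟨C, hC⟩ := exists_cost_lower_bound hA1 hA2
  obtain ⟨x₀, hx₀⟩ := D.X_nonempty
  refine ⟨(D.stochasticValue P).toReal, (EReal.coe_toReal ?_ ?_).symm⟩
  · refine ne_of_lt (lt_of_le_of_lt (iInf₂_le x₀ hx₀) (EReal.coe_lt_top _))
  · refine ne_of_gt (lt_of_lt_of_le (EReal.bot_lt_coe C) (le_iInf₂ fun x hx => ?_))
    rw [EReal.coe_le_coe_iff]
    calc C = ∑ ξ, P ξ * C := by rw [← Finset.sum_mul, hP.2, one_mul]
      _ ≤ ∑ ξ, P ξ * (D.c x + (D.loss x ξ).toReal) :=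
        Finset.sum_le_sum fun ξ _ => mul_le_mul_of_nonneg_left (hC x hx ξ) (hP.1 ξ)
      _ = _ := by
        simp only [mul_add, Finset.sum_add_distrib, ← Finset.sum_mul, hP.2, one_mul, expectedLoss]

/-- Stability of the stochastic value: a sequence that is at least the sample average value and at
most, at every first-stage decision, the sample average cost up to vanishing errors, converges to
the true value. -/
theorem tendsto_of_sampleAverage_bounds (hA1 : D.CompleteRecourse) (hA2 : D.ExpensiveRecourse)
    {P : D.Xi → ℝ} (hP : P ∈ stdSimplex ℝ D.Xi) {v : ℝ} (hv : D.stochasticValue P = (v : EReal))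
    {p : ℕ → D.Xi → ℝ} (hp : ∀ N ≠ 0, p N ∈ stdSimplex ℝ D.Xi)
    (hpP : ∀ ξ, Tendsto (fun N => p N ξ) atTop (𝓝 (P ξ)))
    {ε : ℕ → ℝ} (hε : Tendsto ε atTop (𝓝 0)) {V : ℕ → EReal}
    (hlow : ∀ N ≠ 0, D.stochasticValue (p N) ≤ V N)
    (hup : ∀ x ∈ D.X, ∀ δ > 0, ∃ K : ℝ, ∀ N ≠ 0,
      V N ≤ ((D.c x + K * ε N + (D.expectedLoss x (p N) + δ) : ℝ) : EReal)) :
    Tendsto V atTop (𝓝 (v : EReal)) := by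
  refine tendsto_order.2 ⟨fun a ha => ?_, fun a ha => ?_⟩
  · obtain ⟨a', ha', hav⟩ := EReal.lt_iff_exists_real_btwn.1 ha
    have hav : a' < v := EReal.coe_lt_coe_iff.1 hav
    obtain ⟨C', hC'⟩ := exists_cost_lower_bound hA1 hA2
    let C := min C' v
    have hC : ∀ x ∈ D.X, ∀ ξ : D.Xi, C ≤ D.c x + (D.loss x ξ).toReal :=
      fun x hx ξ => (min_le_left _ _).trans (hC' x hx ξ)
    have hCv : C ≤ v := min_le_right _ _
    -- Chosen so that `C + (1 - δ) * (v - C) ≥ a'`; the `+ 1` covers the case `v = C`.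
    let δ := min 1 ((v - a') / (v - C + 1))
    have hδ : 0 < δ := lt_min one_pos (div_pos (by linarith) (by linarith))
    have hδ1 : δ ≤ 1 := min_le_left _ _
    have hδv : δ * (v - C) ≤ v - a' := by
      have h1 : δ * (v - C + 1) ≤ v - a' := by
        have := min_le_right 1 ((v - a') / (v - C + 1))
        rwa [le_div_iff₀ (by linarith)] at this
      nlinarith
    have hev : ∀ᶠ N in atTop, ∀ ξ, N ≠ 0 → (1 - δ) * P ξ ≤ p N ξ := by
      rw [eventually_all]
      intro ξ
      rcases eq_or_lt_of_le (hP.1 ξ) with h0 | h0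
      · filter_upwards with N hN
        rw [← h0, mul_zero]
        exact (hp N hN).1 ξ
      · have : (1 - δ) * P ξ < P ξ := by nlinarith
        filter_upwards [(hpP ξ).eventually_const_lt this] with N hN _ using hN.le
    filter_upwards [hev, eventually_ne_atTop 0] with N hN hN0
    refine ha'.trans_le (le_trans ?_ (hlow N hN0))
    refine le_iInf₂ fun x hx => EReal.coe_le_coe_iff.2 ?_
    have hvx : v ≤ D.c x + D.expectedLoss x P := by
      rw [← EReal.coe_le_coe_iff, ← hv]
      exact iInf₂_le x hx
    -- Subtracting `C` makes every summand nonnegative, so the comparison of weights applies term by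
    -- term and uniformly in `x`.
    have hsum : ∀ w : D.Xi → ℝ, w ∈ stdSimplex ℝ D.Xi → D.c x + D.expectedLoss x w =
        C + ∑ ξ, w ξ * (D.c x + (D.loss x ξ).toReal - C) := by
      intro w hw
      simp only [mul_sub, mul_add, Finset.sum_sub_distrib, Finset.sum_add_distrib,
        ← Finset.sum_mul, hw.2, expectedLoss]
      ring
    rw [hsum _ hP] at hvx
    rw [hsum _ (hp N hN0)]
    have h1 : (1 - δ) * ∑ ξ, P ξ * (D.c x + (D.loss x ξ).toReal - C) ≤
        ∑ ξ, p N ξ * (D.c x + (D.loss x ξ).toReal - C) := by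
      rw [Finset.mul_sum]
      refine Finset.sum_le_sum fun ξ _ => ?_
      rw [← mul_assoc]
      exact mul_le_mul_of_nonneg_right (hN ξ hN0) (sub_nonneg.2 (hC x hx ξ))
    have h2 := mul_le_mul_of_nonneg_left hvx (sub_nonneg.2 hδ1)
    nlinarith
  · obtain ⟨a', hva, ha'⟩ := EReal.lt_iff_exists_real_btwn.1 ha
    rw [← hv, stochasticValue] at hva
    simp only [iInf_lt_iff] at hva
    obtain ⟨x, hx, hxa⟩ := hva
    have hxa : D.c x + D.expectedLoss x P < a' := EReal.coe_lt_coe_iff.1 hxa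
    obtain ⟨K, hK⟩ := hup x hx ((a' - (D.c x + D.expectedLoss x P)) / 2) (by linarith)
    have hlim : Tendsto (fun N => D.c x + K * ε N + (D.expectedLoss x (p N) +
        (a' - (D.c x + D.expectedLoss x P)) / 2)) atTop
        (𝓝 (D.c x + K * 0 + (D.expectedLoss x P + (a' - (D.c x + D.expectedLoss x P)) / 2))) := by
      refine (tendsto_const_nhds.add (hε.const_mul K)).add (Tendsto.add ?_ tendsto_const_nhds)
      exact tendsto_finsetSum _ fun ξ _ => (hpP ξ).mul_const _
    have hlt := hlim.eventually_lt_const (u := a') (by linarith)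
    filter_upwards [hlt, eventually_ne_atTop 0] with N hN hN0
    exact ((hK N hN0).trans (EReal.coe_le_coe_iff.2 hN.le)).trans_lt ha'

end TwoStageProblem

theorem EReal.coe_finsetSum {ι : Type*} (s : Finset ι) (f : ι → ℝ) :
    ((∑ i ∈ s, f i : ℝ) : EReal) = ∑ i ∈ s, (f i : EReal) := by
  classical
  induction s using Finset.induction_on with
  | empty => simp
  | insert i s hi ih => rw [Finset.sum_insert hi, Finset.sum_insert hi, EReal.coe_add, ih]

namespace TwoStageProblem

variable {N₁ N₂ L M F : ℕ} {D : TwoStageProblem N₁ N₂ L M F}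

/-! ### The distributionally robust problem -/

theorem diagonal_isCoupling {p : D.Xi → ℝ} (hp : p ∈ stdSimplex ℝ D.Xi) :
    D.IsCoupling p p (fun ξ ξ' => if ξ = ξ' then p ξ else 0) := by
  refine ⟨fun ξ ξ' => ?_, fun ξ => by simp, fun ξ' => by simp⟩
  dsimp only
  split_ifs
  exacts [hp.1 ξ, le_rfl]

theorem product_isCoupling {p p' : D.Xi → ℝ} (hp : p ∈ stdSimplex ℝ D.Xi)
    (hp' : p' ∈ stdSimplex ℝ D.Xi) : D.IsCoupling p p' (fun ξ ξ' => p ξ * p' ξ') := by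
  refine ⟨fun ξ ξ' => mul_nonneg (hp.1 ξ) (hp'.1 ξ'), fun ξ => ?_, fun ξ' => ?_⟩
  · rw [← Finset.mul_sum, hp'.2, mul_one]
  · rw [← Finset.sum_mul, hp.2, one_mul]

theorem wasserstein_self_nonpos {p : D.Xi → ℝ} (hp : p ∈ stdSimplex ℝ D.Xi) :
    D.wasserstein p p ≤ 0 := by
  refine csInf_le ⟨0, ?_⟩ ⟨_, diagonal_isCoupling hp, ?_⟩
  · rintro t ⟨γ, hγ, rfl⟩
    exact Finset.sum_nonneg fun ξ _ => Finset.sum_nonneg fun ξ' _ =>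
      mul_nonneg (apply_nonneg D.nrm _) (hγ.1 ξ ξ')
  · simp

/-- The support is finite, so the sum of all difference quotients is a Lipschitz constant; diagonal
pairs contribute `0` because division by zero is zero. The added `1` makes it positive. -/
theorem exists_lipschitz_loss (D : TwoStageProblem N₁ N₂ L M F) (x : Fin N₁ → ℝ) :
    ∃ K > 0, ∀ ξ ξ' : D.Xi, (D.loss x ξ).toReal - (D.loss x ξ').toReal ≤
      K * D.nrm ((ξ : Fin M → ℝ) - ξ') := by
  let f : D.Xi × D.Xi → ℝ := fun w =>
    |(D.loss x w.1).toReal - (D.loss x w.2).toReal| / D.nrm ((w.1 : Fin M → ℝ) - w.2)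
  have hf : ∀ w, 0 ≤ f w := fun w => div_nonneg (abs_nonneg _) (apply_nonneg D.nrm _)
  refine ⟨∑ w, f w + 1, by linarith [Finset.sum_nonneg fun w (_ : w ∈ Finset.univ) => hf w],
    fun ξ ξ' => ?_⟩
  rcases eq_or_lt_of_le (apply_nonneg D.nrm ((ξ : Fin M → ℝ) - ξ')) with h | h
  · have : (ξ : Fin M → ℝ) = ξ' := sub_eq_zero.1 (D.nrm_definite _ h.symm)
    simp [this]
  · have h1 := Finset.single_le_sum (fun w _ => hf w) (Finset.mem_univ (ξ, ξ'))
    calc _ ≤ |(D.loss x ξ).toReal - (D.loss x ξ').toReal| := le_abs_self _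
      _ = f (ξ, ξ') * D.nrm ((ξ : Fin M → ℝ) - ξ') := by
        simp only [f]
        rw [div_mul_cancel₀ _ h.ne']
      _ ≤ _ := mul_le_mul_of_nonneg_right (by linarith) h.le

/-- The Kantorovich bound for the expected loss. -/
theorem expectedLoss_sub_le {x : Fin N₁ → ℝ} {K : ℝ} (hK : 0 < K)
    (hlip : ∀ ξ ξ' : D.Xi, (D.loss x ξ).toReal - (D.loss x ξ').toReal ≤
      K * D.nrm ((ξ : Fin M → ℝ) - ξ'))
    {p p' : D.Xi → ℝ} (hp : p ∈ stdSimplex ℝ D.Xi) (hp' : p' ∈ stdSimplex ℝ D.Xi) :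
    D.expectedLoss x p - D.expectedLoss x p' ≤ K * D.wasserstein p p' := by
  rw [mul_comm, ← div_le_iff₀ hK]
  -- The product coupling shows that the infimum is not over the empty set.
  refine le_csInf ⟨_, _, product_isCoupling hp hp', rfl⟩ ?_
  rintro t ⟨γ, ⟨h0, h1, h2⟩, rfl⟩
  rw [div_le_iff₀ hK, Finset.sum_mul]
  have e1 : D.expectedLoss x p = ∑ ξ : D.Xi, ∑ ξ' : D.Xi, γ ξ ξ' * (D.loss x ξ).toReal := by
    simp only [expectedLoss, ← h1, Finset.sum_mul]
  have e2 : D.expectedLoss x p' = ∑ ξ : D.Xi, ∑ ξ' : D.Xi, γ ξ ξ' * (D.loss x ξ').toReal := by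
    rw [Finset.sum_comm]
    simp only [expectedLoss, ← h2, Finset.sum_mul]
  rw [e1, e2, ← Finset.sum_sub_distrib]
  refine Finset.sum_le_sum fun ξ _ => ?_
  rw [← Finset.sum_sub_distrib, Finset.sum_mul]
  refine Finset.sum_le_sum fun ξ' _ => ?_
  calc _ = γ ξ ξ' * ((D.loss x ξ).toReal - (D.loss x ξ').toReal) := by ring
    _ ≤ γ ξ ξ' * (K * D.nrm ((ξ : Fin M → ℝ) - ξ')) :=
      mul_le_mul_of_nonneg_left (hlip ξ ξ') (h0 ξ ξ')
    _ = _ := by ring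

theorem stochasticValue_le_droValue {N : ℕ} (hN : N ≠ 0) {ε : ℝ} (hε : 0 ≤ ε) (s : Fin N → D.Xi) :
    D.stochasticValue (D.empirical s) ≤ D.droValue ε s := by
  refine iInf₂_mono fun x _ => ?_
  rw [EReal.coe_add]
  refine add_le_add_right ?_ _
  exact le_iSup₂_of_le (D.empirical s) ⟨empirical_mem_stdSimplex hN s,
    (wasserstein_self_nonpos (empirical_mem_stdSimplex hN s)).trans hε⟩ le_rfl

theorem exists_droValue_le {x : Fin N₁ → ℝ} (hx : x ∈ D.X) :
    ∃ K : ℝ, ∀ {N : ℕ} (_ : N ≠ 0) (ε : ℝ) (s : Fin N → D.Xi),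
      D.droValue ε s ≤ ((D.c x + K * ε + D.expectedLoss x (D.empirical s) : ℝ) : EReal) := by
  obtain ⟨K, hK, hlip⟩ := D.exists_lipschitz_loss x
  refine ⟨K, fun hN ε s => (iInf₂_le x hx).trans ?_⟩
  rw [add_assoc, EReal.coe_add]
  refine add_le_add_right (iSup₂_le fun p hp => EReal.coe_le_coe_iff.2 ?_) _
  have h1 := expectedLoss_sub_le hK hlip hp.1 (empirical_mem_stdSimplex hN s)
  have h2 := mul_le_mul_of_nonneg_left hp.2 hK.le
  linarith

/-! ### Bounds on reformulation values -/

section reform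

variable {V : Type*} {g : (Fin N₁ → ℝ) → V → ℝ} {τ : V → ℝ} {N : ℕ} {ε : ℝ} {s : Fin N → D.Xi}
  {S : Fin N → Set V}

/-- A point with `τ = 0` escapes the penalty, so it bounds the inner supremum below by the loss
whatever `α` is. -/
theorem stochasticValue_le_reformValue (hε : 0 ≤ ε)
    (h : ∀ x ∈ D.X, ∀ i, ∃ z ∈ S i, τ z = 0 ∧ (D.loss x (s i)).toReal ≤ g x z) :
    D.stochasticValue (D.empirical s) ≤ D.reformValue g τ ε S := by
  refine le_iInf₂ fun x hx => le_iInf₂ fun α hα => (iInf₂_le x hx).trans ?_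
  rw [expectedLoss_empirical, EReal.coe_add, EReal.coe_mul, EReal.coe_finsetSum]
  refine add_le_add (EReal.coe_le_coe_iff.2 ?_) (mul_le_mul_of_nonneg_left
    (Finset.sum_le_sum fun i _ => ?_) (EReal.coe_nonneg.2 (by positivity)))
  · linarith [mul_nonneg (show 0 ≤ α from hα) hε]
  · obtain ⟨z, hz, hτ, hle⟩ := h x hx i
    refine le_iSup₂_of_le z hz (EReal.coe_le_coe_iff.2 ?_)
    rw [hτ]
    linarith

theorem reformValue_le (hN : N ≠ 0) {x : Fin N₁ → ℝ} (hx : x ∈ D.X) {α : ℝ} (hα : 0 ≤ α) {δ : ℝ}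
    (h : ∀ i, ∀ z ∈ S i, g x z - α * τ z ≤ (D.loss x (s i)).toReal + δ) :
    D.reformValue g τ ε S ≤
      ((D.c x + α * ε + (D.expectedLoss x (D.empirical s) + δ) : ℝ) : EReal) := by
  refine (iInf₂_le x hx).trans ((iInf₂_le α hα).trans ?_)
  have hδ : D.expectedLoss x (D.empirical s) + δ =
      (1 / (N : ℝ)) * ∑ i, ((D.loss x (s i)).toReal + δ) := by
    rw [expectedLoss_empirical, Finset.sum_add_distrib, mul_add]
    simp [hN]
  rw [hδ, EReal.coe_add (D.c x + α * ε), EReal.coe_mul (1 / (N : ℝ)), EReal.coe_finsetSum]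
  refine add_le_add_right (mul_le_mul_of_nonneg_left (Finset.sum_le_sum fun i _ => ?_)
    (EReal.coe_nonneg.2 (by positivity))) _
  exact iSup₂_le fun z hz => EReal.coe_le_coe_iff.2 (h i z hz)

end reform

/-- Slopes found separately for the points of the support can be replaced by a common one. -/
theorem exists_common_slope {V : Type*} {g τ : V → ℝ} {S : (Fin M → ℝ) → Set V}
    (hτ : ∀ ξ, ∀ z ∈ S ξ, 0 ≤ τ z) {r : D.Xi → ℝ}
    (h : ∀ ξ : D.Xi, ∃ α ≥ 0, ∀ z ∈ S ξ, g z - α * τ z ≤ r ξ) :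
    ∃ α ≥ 0, ∀ ξ : D.Xi, ∀ z ∈ S ξ, g z - α * τ z ≤ r ξ := by
  choose α hα h using h
  refine ⟨∑ ξ, α ξ, Finset.sum_nonneg fun ξ _ => hα ξ, fun ξ z hz => ?_⟩
  have h1 := Finset.single_le_sum (fun ξ _ => hα ξ) (Finset.mem_univ ξ)
  linarith [h ξ z hz, mul_le_mul_of_nonneg_right h1 (hτ ξ z hz)]

theorem isClosed_dualCone : IsClosed D.dualCone := by
  simp only [dualCone, Set.ofPred_forall]
  refine isClosed_iInter fun y => isClosed_iInter fun _ => isClosed_le continuous_const ?_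
  simp only [dotProduct]
  fun_prop

/-- A convex function on a finite-dimensional space is continuous in the interior of its domain. -/
theorem continuous_nrm : Continuous D.nrm := by
  have := D.nrm.convexOn.continuousOn_interior
  rwa [interior_univ, continuousOn_univ] at this

/-! ### The linearized representation -/

theorem WAt_transpose_mulVec (ξ : Fin M → ℝ) (lam : Fin L → ℝ) :
    (D.WAt ξ)ᵀ *ᵥ lam = D.W₀ᵀ *ᵥ lam + ∑ j, (D.W j)ᵀ *ᵥ (fun l => lam l * ξ j) := by
  rw [WAt, transpose_add, add_mulVec, transpose_sum, sum_mulVec]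
  congr 1
  refine Finset.sum_congr rfl fun j _ => ?_
  rw [transpose_smul, smul_mulVec, ← mulVec_smul]
  congr 1
  funext l
  simp [mul_comm]

theorem linearizedObjective_mul (x : Fin N₁ → ℝ) (ξ : Fin M → ℝ) (lam : Fin L → ℝ) (t : ℝ) :
    D.linearizedObjective x (ξ, lam, Matrix.of fun l j => lam l * ξ j, t) =
      lam ⬝ᵥ (D.T x *ᵥ ξ + D.h x) := by
  simp only [linearizedObjective, Matrix.of_apply, dotProduct_add, dotProduct_comm (D.h x)]
  congr 1
  simp only [dotProduct, mulVec, Finset.mul_sum]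
  exact Finset.sum_congr rfl fun l _ => Finset.sum_congr rfl fun j _ => by ring

/-- An optimal multiplier with `Λ = λ ξᵀ` works: since `ξ` is binary and `λ ≤ lamBar`, this product
satisfies the McCormick inequalities. -/
theorem exists_mem_linearizedSet (hA1 : D.CompleteRecourse) (hA2 : D.ExpensiveRecourse)
    {lamBar : Fin L → ℝ} (hbar : D.IsDualBound lamBar) {x : Fin N₁ → ℝ} (hx : x ∈ D.X) (ξ : D.Xi) :
    ∃ z ∈ D.linearizedSet D.XiRelaxed lamBar ξ, z.2.2.2 = 0 ∧
      (D.loss x ξ).toReal ≤ D.linearizedObjective x z := by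
  obtain ⟨lam, hlam, hdual, hle⟩ := exists_dual_optimal hA1 hA2 hx ξ.2
  have hb := hbar.2 ξ ξ.2 lam hlam hdual
  refine ⟨((ξ : Fin M → ℝ), lam, Matrix.of fun l j => lam l * (ξ : Fin M → ℝ) j, 0),
    ⟨mem_XiRelaxed_of_mem_Xi ξ.2, hlam, fun l j => ?_, le_rfl, by simp, fun l j => ?_, fun l j => ?_,
      fun l j => ?_, ?_⟩, rfl, ?_⟩
  · exact mul_nonneg (hlam l) (nonneg_of_mem_Xi ξ.2 j)
  · have := hb l
    rcases (mem_Xi.1 ξ.2).1 j with h | h <;> simp [h]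
    exact this
  · have := hlam l
    rcases (mem_Xi.1 ξ.2).1 j with h | h <;> simp [h]
    exact this
  · have := hb l
    rcases (mem_Xi.1 ξ.2).1 j with h | h <;> simp [h]
    exact this
  · rw [WAt_transpose_mulVec, qAt, ← sub_sub] at hdual
    exact hdual
  · rw [linearizedObjective_mul]
    exact hle

/-- On the linearized set the dual variables are bounded. -/
theorem le_lamBar_of_mem_linearizedSet {lamBar : Fin L → ℝ} (hbar : D.IsDualBound lamBar) (ξ : D.Xi)
    {z : (Fin M → ℝ) × (Fin L → ℝ) × Matrix (Fin L) (Fin M) ℝ × ℝ}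
    (hz : z ∈ D.linearizedSet D.XiRelaxed lamBar ξ) : z.2.1 ≤ lamBar := by
  obtain ⟨ζ, lam, Lam, t⟩ := z
  obtain ⟨hζ, hlam, hLam, ht, hn, h1, h2, h3, h4⟩ := hz
  -- For `M = 0` there are no McCormick inequalities, but then `ζ = ξ` and the dual bound applies
  -- directly. Otherwise the lower and upper inequalities for any one `j` combine to the claim.
  rcases Nat.eq_zero_or_pos M with rfl | hM
  · obtain rfl : ζ = ξ := Subsingleton.elim _ _
    refine hbar.2 ξ ξ.2 lam hlam ?_
    rw [WAt_transpose_mulVec, qAt, ← sub_sub]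
    simpa using h4
  · intro l
    have := h1 l ⟨0, hM⟩
    have := h3 l ⟨0, hM⟩
    change lam l ≤ lamBar l
    linarith

/-- At the binary point `ξ` the McCormick inequalities force `Λ = λ ξᵀ`, so weak duality bounds the
objective by the loss. The unbounded variable `τ` is eliminated through `nrm (ζ - ξ) ≤ τ`, leaving a
compact set with that norm as penalty. -/
theorem exists_linearized_slope (hA2 : D.ExpensiveRecourse) {lamBar : Fin L → ℝ}
    (hbar : D.IsDualBound lamBar) {x : Fin N₁ → ℝ} (hx : x ∈ D.X) {δ : ℝ} (hδ : 0 < δ) (ξ : D.Xi) :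
    ∃ α ≥ 0, ∀ z ∈ D.linearizedSet D.XiRelaxed lamBar ξ,
      D.linearizedObjective x z - α * z.2.2.2 ≤ (D.loss x ξ).toReal + δ := by
  let B : Set ((Fin M → ℝ) × (Fin L → ℝ) × (Fin L → Fin M → ℝ)) :=
    Set.Icc 0 1 ×ˢ Set.Icc 0 lamBar ×ˢ Set.Icc 0 (fun l _ => lamBar l)
  let A : Set ((Fin M → ℝ) × (Fin L → ℝ) × (Fin L → Fin M → ℝ)) :=
    {w | ((∀ l j, w.2.1 l ≤ w.2.2 l j + lamBar l * (1 - w.1 j)) ∧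
      (∀ l j, w.2.2 l j ≤ w.2.1 l) ∧ (∀ l j, w.2.2 l j ≤ lamBar l * w.1 j)) ∧
      D.q₀ + D.Qmat *ᵥ w.1 - D.W₀ᵀ *ᵥ w.2.1 -
        ∑ j, (D.W j)ᵀ *ᵥ (fun l => w.2.2 l j) ∈ D.dualCone}
  have hAc : IsClosed A := by
    refine IsClosed.and ?_ (isClosed_dualCone.preimage ?_)
    · simp only [Set.ofPred_and, Set.ofPred_forall]
      refine IsClosed.inter ?_ (IsClosed.inter ?_ ?_) <;>
      · refine isClosed_iInter fun l => isClosed_iInter fun j => isClosed_le ?_ ?_ <;> fun_prop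
    · refine ((continuous_const.add (continuous_const.matrix_mulVec continuous_fst)).sub
        (continuous_const.matrix_mulVec (by fun_prop))).sub ?_
      exact continuous_finsetSum _ fun j _ => continuous_const.matrix_mulVec (by fun_prop)
  have hK : IsCompact (B ∩ A) :=
    (isCompact_Icc.prod (isCompact_Icc.prod isCompact_Icc)).inter_right hAc
  obtain ⟨α, hα, h⟩ := hK.exists_penalty_slope
    (g := fun w => D.linearizedObjective x (w.1, w.2.1, Matrix.of w.2.2, 0))
    (d := fun w => D.nrm (w.1 - ξ)) (q := (D.loss x ξ).toReal)
    (by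
      refine Continuous.continuousOn ?_
      simp only [linearizedObjective, dotProduct, Matrix.of_apply]
      fun_prop)
    (continuous_nrm.comp (continuous_fst.sub continuous_const)).continuousOn
    (fun w _ => apply_nonneg D.nrm _)
    (by
      rintro ⟨ζ, lam, Lam⟩ ⟨⟨-, hlam, hLam⟩, ⟨h1, h2, h3⟩, h4⟩ hd
      obtain rfl : ζ = ξ := sub_eq_zero.1 (D.nrm_definite _ hd)
      have hL : Lam = fun l j => lam l * (ξ : Fin M → ℝ) j := by
        funext l j
        have h1 := h1 l j
        have h2 := h2 l j
        have h3 := h3 l j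
        have h0 : 0 ≤ Lam l j := hLam.1 l j
        simp only at h1 h2 h3
        rcases (mem_Xi.1 ξ.2).1 j with h | h
        · rw [h] at h3 ⊢
          linarith
        · rw [h] at h1 ⊢
          linarith
      subst hL
      simp only
      rw [linearizedObjective_mul, ← EReal.coe_le_coe_iff, coe_toReal_loss hA2 hx ξ.2]
      refine dual_le_loss hlam.1 ?_
      rw [WAt_transpose_mulVec, qAt, ← sub_sub]
      exact h4) hδ
  refine ⟨α, hα, fun z hz => ?_⟩
  have hle := le_lamBar_of_mem_linearizedSet hbar ξ hz
  obtain ⟨ζ, lam, Lam, t⟩ := z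
  obtain ⟨hζ, hlam, hLam, ht, hn, h1, h2, h3, h4⟩ := hz
  have hmem : ((ζ, lam, fun l j => Lam l j) :
      (Fin M → ℝ) × (Fin L → ℝ) × (Fin L → Fin M → ℝ)) ∈ B ∩ A := by
    refine ⟨⟨⟨fun j => (hζ.1 j).1, fun j => (hζ.1 j).2⟩, ⟨hlam, hle⟩, ⟨fun l j => hLam l j,
      fun l j => ?_⟩⟩, ⟨fun l j => ?_, fun l j => ?_, fun l j => ?_⟩, h4⟩
    · exact (sub_nonneg.1 (h2 l j)).trans (hle l)
    · linarith [h1 l j]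
    · linarith [h2 l j]
    · linarith [h3 l j]
  have h5 := h _ hmem
  have h6 := mul_le_mul_of_nonneg_left hn hα
  have h7 : D.linearizedObjective x (ζ, lam, Lam, t) =
    D.linearizedObjective x (ζ, lam, Matrix.of fun l j => Lam l j, 0) := rfl
  rw [h7]
  simp only at h5 ⊢
  linarith

end TwoStageProblem

namespace TwoStageProblem

variable {N₁ N₂ L M F : ℕ} {D : TwoStageProblem N₁ N₂ L M F}

/-! ### The penalty representation -/

theorem dotProduct_mulVec_eq_sum (T₀ : Matrix (Fin L) (Fin M) ℝ) (lam : Fin L → ℝ)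
    (ζ : Fin M → ℝ) : lam ⬝ᵥ (T₀ *ᵥ ζ) = ∑ j, (T₀ᵀ *ᵥ lam) j * ζ j := by
  rw [← dotProduct_transpose_mulVec]
  rfl

/-- Weak duality for the penalized second-stage problem. -/
theorem dual_le_penaltyLoss {T₀ : Matrix (Fin L) (Fin M) ℝ} {ρ : ℝ} {x : Fin N₁ → ℝ}
    {ξ : Fin M → ℝ} {lam : Fin L → ℝ} {mu : Fin M → ℝ} (hlam : 0 ≤ lam) (hmu : 0 ≤ mu)
    (hdual : D.qAt ξ - D.W₀ᵀ *ᵥ lam ∈ D.dualCone)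
    (hbox : ∀ j, 0 ≤ ρ * (1 - 2 * ξ j) + (T₀ᵀ *ᵥ lam) j + mu j) :
    ((D.h x ⬝ᵥ lam + ρ * ∑ j, ξ j - ∑ j, mu j : ℝ) : EReal) ≤ D.penaltyLoss T₀ ρ x ξ := by
  refine le_iInf₂ fun yz hyz => EReal.coe_le_coe_iff.2 ?_
  obtain ⟨hy, hz, hfeas⟩ := hyz
  have h1 := dotProduct_le_dotProduct_of_nonneg_left hfeas hlam
  have h2 := sub_mem_dualCone_iff.1 hdual yz.1 hy
  rw [dotProduct_add, dotProduct_mulVec_eq_sum, dotProduct_comm lam (D.h x)] at h1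
  have h3 : 0 ≤ ∑ j, (ρ * ((1 - 2 * ξ j) * yz.2 j) + (T₀ᵀ *ᵥ lam) j * yz.2 j + mu j) := by
    refine Finset.sum_nonneg fun j _ => ?_
    have h4 := mul_nonneg (hbox j) (hz j).1
    have h5 := mul_nonneg (hmu j) (sub_nonneg.2 (hz j).2)
    linarith
  rw [Finset.sum_add_distrib, Finset.sum_add_distrib, ← Finset.mul_sum] at h3
  linarith

/-- The penalized problem relaxes the second-stage problem. -/
theorem penaltyLoss_le_loss {T₀ : Matrix (Fin L) (Fin M) ℝ} (hfix : D.FixedRecourse T₀) (ρ : ℝ)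
    {x : Fin N₁ → ℝ} (hx : x ∈ D.X) {ξ : Fin M → ℝ} (hξ : ξ ∈ D.Xi) :
    D.penaltyLoss T₀ ρ x ξ ≤ D.loss x ξ := by
  refine le_iInf₂ fun y hy => ?_
  obtain ⟨hyY, hfeas⟩ := hy
  rw [hfix.1 ξ hξ, hfix.2 x hx] at hfeas
  refine (iInf₂_le (y, ξ) ⟨hyY, (mem_XiRelaxed_of_mem_Xi hξ).1, hfeas⟩).trans
    (EReal.coe_le_coe_iff.2 (le_of_eq ?_))
  have : ∑ j, (1 - 2 * ξ j) * ξ j + ∑ j, ξ j = 0 := by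
    rw [← Finset.sum_add_distrib]
    refine Finset.sum_eq_zero fun j _ => ?_
    rcases (mem_Xi.1 hξ).1 j with h | h <;> rw [h] <;> norm_num
  simp only [this, mul_zero, add_zero]

/-- Every sufficiently large parameter is an exact penalty parameter. -/
theorem exists_isExactPenalty (hA1 : D.CompleteRecourse) (hA2 : D.ExpensiveRecourse)
    {T₀ : Matrix (Fin L) (Fin M) ℝ} (hfix : D.FixedRecourse T₀) :
    ∃ ρ₀ > 0, ∀ ρ ≥ ρ₀, D.IsExactPenalty T₀ ρ := by
  obtain ⟨lamBar, hbar⟩ := exists_isDualBound hA1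
  have hcol : ∀ j, 0 ≤ ∑ l, |T₀ l j| * lamBar l := fun j =>
    Finset.sum_nonneg fun l _ => mul_nonneg (abs_nonneg _) (hbar.1 l)
  -- This dominates every entry of `T₀ᵀ *ᵥ lam` for dual feasible `lam`; the added `1` makes it
  -- positive.
  refine ⟨∑ j, ∑ l, |T₀ l j| * lamBar l + 1, by
    linarith [Finset.sum_nonneg fun j (_ : j ∈ Finset.univ) => hcol j], fun ρ hρ x hx ξ hξ => ?_⟩
  refine le_antisymm (penaltyLoss_le_loss hfix ρ hx hξ) ?_
  obtain ⟨lam, hlam, hdual, hle⟩ := exists_dual_optimal hA1 hA2 hx hξ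
  have hb := hbar.2 ξ hξ lam hlam hdual
  have habs : ∀ j, |(T₀ᵀ *ᵥ lam) j| ≤ ρ := by
    intro j
    have h1 : |(T₀ᵀ *ᵥ lam) j| ≤ ∑ l, |T₀ l j| * lamBar l := by
      simp only [mulVec, dotProduct, transpose_apply]
      refine (Finset.abs_sum_le_sum_abs _ _).trans (Finset.sum_le_sum fun l _ => ?_)
      rw [abs_mul, abs_of_nonneg (hlam l)]
      exact mul_le_mul_of_nonneg_left (hb l) (abs_nonneg _)
    have h2 := Finset.single_le_sum (fun j _ => hcol j) (Finset.mem_univ j)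
    linarith
  rw [hfix.1 ξ hξ] at hdual
  rw [hfix.2 x hx] at hle
  -- With this `mu` the box constraint is tight where `ξ j = 1`, and the penalized dual objective
  -- equals `lam ⬝ᵥ (T₀ *ᵥ ξ + D.h x)`.
  have hweak := dual_le_penaltyLoss (x := x) (ρ := ρ) (T₀ := T₀) (ξ := ξ)
    (mu := fun j => ξ j * (ρ - (T₀ᵀ *ᵥ lam) j)) hlam
    (fun j => mul_nonneg (nonneg_of_mem_Xi hξ j)
      (by linarith [le_abs_self ((T₀ᵀ *ᵥ lam) j), habs j]))
    hdual (fun j => by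
      have := neg_abs_le ((T₀ᵀ *ᵥ lam) j)
      have := habs j
      rcases (mem_Xi.1 hξ).1 j with h | h <;> simp only [h] <;> linarith)
  rw [← coe_toReal_loss hA2 hx hξ]
  refine le_trans (EReal.coe_le_coe_iff.2 (hle.trans (le_of_eq ?_))) hweak
  rw [dotProduct_add, dotProduct_mulVec_eq_sum, dotProduct_comm lam (D.h x), Finset.mul_sum,
    add_sub_assoc, ← Finset.sum_sub_distrib, add_comm]
  congr 1
  exact Finset.sum_congr rfl fun j _ => by ring

/-- Strong duality for the penalized problem: its dual, with the box multipliers, is attained. -/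
theorem exists_mem_penaltySet (hA1 : D.CompleteRecourse) (hA2 : D.ExpensiveRecourse)
    {T₀ : Matrix (Fin L) (Fin M) ℝ} (hfix : D.FixedRecourse T₀) {ρ : ℝ}
    (hρ : D.IsExactPenalty T₀ ρ) {x : Fin N₁ → ℝ} (hx : x ∈ D.X) (ξ : D.Xi) :
    ∃ z ∈ D.penaltySet D.XiRelaxed T₀ ρ ξ, z.2.2.2 = 0 ∧
      (D.loss x ξ).toReal ≤ D.penaltyObjective ρ x z := by
  obtain ⟨y₀, hy₀, hs⟩ := exists_strictly_feasible (hA1.exists_pos ξ.2) (D.h x)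
  rw [hfix.1 ξ ξ.2] at hs
  let C : Set ((Fin N₂ → ℝ) × (Fin M → ℝ)) := (D.Y : Set (Fin N₂ → ℝ)) ×ˢ Set.Icc 0 1
  have hC : Convex ℝ C := D.Y_convex.prod (convex_Icc 0 1)
  obtain ⟨lam, hlam, h⟩ := exists_lagrange_multiplier hC
    (φ := fun u => D.qAt ξ ⬝ᵥ u.1 +
      ρ * (∑ j, (1 - 2 * (ξ : Fin M → ℝ) j) * u.2 j + ∑ j, (ξ : Fin M → ℝ) j))
    (G := fun u => D.W₀ *ᵥ u.1 - (T₀ *ᵥ u.2 + D.h x)) (v := (D.loss x ξ).toReal)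
    ⟨hC, fun u _ u' _ a b _ _ hab => by
      have e : ∀ w w' : Fin M → ℝ, ∑ j, (1 - 2 * (ξ : Fin M → ℝ) j) * (a • w + b • w') j =
          a * ∑ j, (1 - 2 * (ξ : Fin M → ℝ) j) * w j +
          b * ∑ j, (1 - 2 * (ξ : Fin M → ℝ) j) * w' j := by
        intro w w'
        rw [Finset.mul_sum, Finset.mul_sum, ← Finset.sum_add_distrib]
        refine Finset.sum_congr rfl fun j _ => ?_
        simp only [Pi.add_apply, Pi.smul_apply, smul_eq_mul]
        ring
      simp only [Prod.fst_add, Prod.snd_add, Prod.smul_fst, Prod.smul_snd, e, dotProduct_add,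
        dotProduct_smul, smul_eq_mul]
      have : b = 1 - a := by linarith
      subst this
      apply le_of_eq
      ring⟩
    (fun l => ⟨hC, fun u _ u' _ a b _ _ hab => by
      simp only [Prod.fst_add, Prod.snd_add, Prod.smul_fst, Prod.smul_snd, mulVec_add, mulVec_smul,
        Pi.sub_apply, Pi.add_apply, Pi.smul_apply, smul_eq_mul]
      have : b = 1 - a := by linarith
      subst this
      apply le_of_eq
      ring⟩)
    (fun u hu hG => by
      rw [← EReal.coe_le_coe_iff, coe_toReal_loss hA2 hx ξ.2, ← hρ x hx ξ ξ.2]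
      exact iInf₂_le u ⟨hu.1, fun j => ⟨hu.2.1 j, hu.2.2 j⟩, sub_nonneg.1 hG⟩)
    (u₀ := (y₀, 0)) ⟨hy₀, le_rfl, zero_le_one⟩ (fun l => by simpa using hs l)
  -- The reduced cost of `ζ j`. Minimizing over the box gives `-∑ j, max 0 (-a j)`, whence the
  -- choice of `mu`; the minimizing vertex is inserted at the end.
  let a : Fin M → ℝ := fun j => ρ * (1 - 2 * (ξ : Fin M → ℝ) j) + (T₀ᵀ *ᵥ lam) j
  have hu : ∀ y ∈ D.Y, ∀ ζ ∈ Set.Icc (0 : Fin M → ℝ) 1, (D.loss x ξ).toReal ≤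
      (D.qAt ξ - D.W₀ᵀ *ᵥ lam) ⬝ᵥ y + ∑ j, a j * ζ j + ρ * ∑ j, (ξ : Fin M → ℝ) j +
        D.h x ⬝ᵥ lam := by
    intro y hy ζ hζ
    have h1 := h (y, ζ) ⟨hy, hζ⟩
    simp only [dotProduct_sub, dotProduct_add, dotProduct_mulVec_eq_sum T₀] at h1
    rw [sub_dotProduct, dotProduct_transpose_mulVec, dotProduct_comm (D.h x)]
    have h2 : ∑ j, a j * ζ j = ρ * ∑ j, (1 - 2 * (ξ : Fin M → ℝ) j) * ζ j +
        ∑ j, (T₀ᵀ *ᵥ lam) j * ζ j := by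
      rw [Finset.mul_sum, ← Finset.sum_add_distrib]
      exact Finset.sum_congr rfl fun j _ => by simp only [a]; ring
    rw [h2]
    linarith
  refine ⟨((ξ : Fin M → ℝ), lam, fun j => max 0 (-a j), 0),
    ⟨mem_XiRelaxed_of_mem_Xi ξ.2, hlam, fun j => le_max_left _ _, le_rfl, by simp, ?_,
      fun j => ?_⟩, rfl, ?_⟩
  · refine mem_dualCone_of_bounded_below (r := (D.loss x ξ).toReal -
      ρ * ∑ j, (ξ : Fin M → ℝ) j - D.h x ⬝ᵥ lam) fun y hy => ?_
    have := hu y hy 0 ⟨le_rfl, zero_le_one⟩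
    simp only [Pi.zero_apply, mul_zero, Finset.sum_const_zero] at this
    rw [qAt] at this
    linarith
  · have := le_max_right 0 (-a j)
    simp only [a] at this ⊢
    linarith
  · have h1 := hu 0 D.Y.zero_mem (fun j => if a j < 0 then 1 else 0)
      ⟨fun j => by dsimp only; split_ifs <;> simp, fun j => by dsimp only; split_ifs <;> simp⟩
    have h2 : ∑ j, a j * (if a j < 0 then 1 else 0) = -∑ j, max 0 (-a j) := by
      rw [← Finset.sum_neg_distrib]
      refine Finset.sum_congr rfl fun j _ => ?_
      split_ifs with hj
      · rw [max_eq_right (by linarith)]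
        ring
      · rw [max_eq_left (by linarith)]
        ring
    rw [h2, dotProduct_zero] at h1
    simp only [penaltyObjective]
    linarith

/-- The variables `mu` and `τ` are unbounded, but `mu` may be replaced by its least feasible value,
continuous in `(ζ, λ)`, and `τ` by the norm. Under fixed recourse one `y` with `W₀ y > 0` bounds `λ`
for all `ζ` in the box. At `ζ = ξ`, weak duality and exactness of `ρ` bound the objective by the
loss. -/
theorem exists_penalty_representation_slope (hA1 : D.CompleteRecourse) (hA2 : D.ExpensiveRecourse)
    {T₀ : Matrix (Fin L) (Fin M) ℝ} (hfix : D.FixedRecourse T₀) {ρ : ℝ}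
    (hρ : D.IsExactPenalty T₀ ρ) {x : Fin N₁ → ℝ} (hx : x ∈ D.X) {δ : ℝ} (hδ : 0 < δ) (ξ : D.Xi) :
    ∃ α ≥ 0, ∀ z ∈ D.penaltySet D.XiRelaxed T₀ ρ ξ,
      D.penaltyObjective ρ x z - α * z.2.2.2 ≤ (D.loss x ξ).toReal + δ := by
  obtain ⟨y, hy, hpos⟩ := hA1.exists_pos ξ.2
  rw [hfix.1 ξ ξ.2] at hpos
  have hqc : Continuous fun ζ : Fin M → ℝ => D.q₀ + D.Qmat *ᵥ ζ :=
    continuous_const.add (continuous_const.matrix_mulVec continuous_id)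
  obtain ⟨R, hR⟩ := (isCompact_Icc (a := (0 : Fin M → ℝ)) (b := 1)).bddAbove_image
    (f := fun ζ => (D.q₀ + D.Qmat *ᵥ ζ) ⬝ᵥ y) (hqc.dotProduct continuous_const).continuousOn
  let B : Set ((Fin M → ℝ) × (Fin L → ℝ)) :=
    Set.Icc 0 1 ×ˢ Set.Icc 0 (fun l => R / (D.W₀ *ᵥ y) l)
  let A : Set ((Fin M → ℝ) × (Fin L → ℝ)) :=
    {w | D.q₀ + D.Qmat *ᵥ w.1 - D.W₀ᵀ *ᵥ w.2 ∈ D.dualCone}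
  have hAc : IsClosed A := isClosed_dualCone.preimage
    ((hqc.comp continuous_fst).sub (continuous_const.matrix_mulVec continuous_snd))
  have hK : IsCompact (B ∩ A) := (isCompact_Icc.prod isCompact_Icc).inter_right hAc
  let m : (Fin M → ℝ) → (Fin L → ℝ) → Fin M → ℝ := fun ζ lam j =>
    max 0 (-(ρ * (1 - 2 * ζ j) + (T₀ᵀ *ᵥ lam) j))
  obtain ⟨α, hα, h⟩ := hK.exists_penalty_slope
    (g := fun w => D.h x ⬝ᵥ w.2 + ρ * ∑ j, w.1 j - ∑ j, m w.1 w.2 j)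
    (d := fun w => D.nrm (w.1 - ξ)) (q := (D.loss x ξ).toReal)
    (by
      refine Continuous.continuousOn ?_
      simp only [m, dotProduct, mulVec]
      fun_prop)
    (continuous_nrm.comp (continuous_fst.sub continuous_const)).continuousOn
    (fun w _ => apply_nonneg D.nrm _)
    (by
      rintro ⟨ζ, lam⟩ ⟨⟨-, hlam⟩, hdual⟩ hd
      obtain rfl : ζ = ξ := sub_eq_zero.1 (D.nrm_definite _ hd)
      rw [← EReal.coe_le_coe_iff, coe_toReal_loss hA2 hx ξ.2, ← hρ x hx ξ ξ.2]
      refine dual_le_penaltyLoss hlam.1 (fun j => le_max_left _ _) hdual fun j => ?_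
      have := le_max_right 0 (-(ρ * (1 - 2 * (ξ : Fin M → ℝ) j) + (T₀ᵀ *ᵥ lam) j))
      simp only [m]
      linarith) hδ
  refine ⟨α, hα, fun z hz => ?_⟩
  obtain ⟨ζ, lam, mu, t⟩ := z
  obtain ⟨hζ, hlam, hmu, ht, hn, hdual, hbox⟩ := hz
  have hζI : ζ ∈ Set.Icc (0 : Fin M → ℝ) 1 := ⟨fun j => (hζ.1 j).1, fun j => (hζ.1 j).2⟩
  have hmem : (ζ, lam) ∈ B ∩ A := by
    refine ⟨⟨hζI, hlam, fun l => ?_⟩, hdual⟩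
    change lam l ≤ R / (D.W₀ *ᵥ y) l
    rw [le_div_iff₀ (hpos l)]
    refine le_trans ?_ ((sub_mem_dualCone_iff.1 hdual y hy).trans (hR ⟨ζ, hζI, rfl⟩))
    exact Finset.single_le_sum (f := fun l => lam l * (D.W₀ *ᵥ y) l)
      (fun k _ => mul_nonneg (hlam k) (hpos k).le) (Finset.mem_univ l)
  have h5 := h _ hmem
  have h6 := mul_le_mul_of_nonneg_left hn hα
  have h7 : ∑ j, m ζ lam j ≤ ∑ j, mu j :=
    Finset.sum_le_sum fun j _ => max_le (hmu j) (by linarith [hbox j])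
  simp only [penaltyObjective] at h5 ⊢
  linarith

/-! ### Almost sure convergence -/

/-- The strong law of large numbers for the indicator of each support point; finitely many null sets
are discarded. -/
theorem ae_tendsto_empirical {P : D.Xi → ℝ} {Ω : Type*} [MeasurableSpace Ω] {μ : Measure Ω}
    [IsProbabilityMeasure μ] {ξhat : ℕ → Ω → D.Xi} (hmeas : ∀ i, Measurable (ξhat i))
    (hindep : iIndepFun ξhat μ) (hlaw : ∀ i ξ, μ.real (ξhat i ⁻¹' {ξ}) = P ξ) :
    ∀ᵐ ω ∂μ, ∀ ξ, Tendsto (fun N : ℕ => D.empirical (fun i : Fin N => ξhat i ω) ξ) atTop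
      (𝓝 (P ξ)) := by
  rw [ae_all_iff]
  intro ξ
  let u : D.Xi → ℝ := fun ξ' => if ξ' = ξ then 1 else 0
  have hu : Measurable u := measurable_of_countable u
  have hid : ∀ i, IdentDistrib (ξhat i) (ξhat 0) μ μ := by
    intro i
    refine ⟨(hmeas i).aemeasurable, (hmeas 0).aemeasurable, Measure.ext_iff_singleton.2 fun a => ?_⟩
    rw [Measure.map_apply (hmeas i) (measurableSet_singleton a),
      Measure.map_apply (hmeas 0) (measurableSet_singleton a)]
    exact (measureReal_eq_measureReal_iff).1 ((hlaw i a).trans (hlaw 0 a).symm)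
  have hind : (u ∘ ξhat 0) = (ξhat 0 ⁻¹' {ξ}).indicator 1 := by
    funext ω
    by_cases h : ξhat 0 ω = ξ <;> simp [u, Set.indicator, h]
  have hS : MeasurableSet (ξhat 0 ⁻¹' {ξ}) := hmeas 0 (measurableSet_singleton ξ)
  have hlln := strong_law_ae_real (fun i => u ∘ ξhat i)
    (by
      rw [hind]
      exact (integrable_const (1 : ℝ)).indicator hS)
    (fun i j hij => (hindep.comp (fun _ => u) fun _ => hu).indepFun hij)
    (fun i => (hid i).comp hu)
  have hint : μ[u ∘ ξhat 0] = P ξ := by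
    rw [hind, integral_indicator_one hS, hlaw]
  rw [hint] at hlln
  filter_upwards [hlln] with ω hω
  refine hω.congr fun N => ?_
  rw [← Fin.sum_univ_eq_sum_range (fun i => (u ∘ ξhat i) ω) N, empirical, one_div, div_eq_inv_mul]
  rfl

end TwoStageProblem

/-! ### The convergence theorem -/

open TwoStageProblem

theorem mainTheorem4 {N₁ N₂ L M F : ℕ} (D : TwoStageProblem N₁ N₂ L M F)
    (hA1 : D.CompleteRecourse) (hA2 : D.ExpensiveRecourse)
    -- the true distribution and an i.i.d. sample from it
    (P : D.Xi → ℝ) (hP : P ∈ stdSimplex ℝ D.Xi)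
    {Ω : Type*} [MeasurableSpace Ω] (μ : Measure Ω) [IsProbabilityMeasure μ]
    (ξhat : ℕ → Ω → D.Xi) (hmeas : ∀ i, Measurable (ξhat i)) (hindep : iIndepFun ξhat μ)
    (hlaw : ∀ i ξ, μ.real (ξhat i ⁻¹' {ξ}) = P ξ)
    -- the radii
    (ε : ℕ → ℝ) (hε0 : ∀ N, 0 ≤ ε N) (hε : Tendsto (fun N : ℕ => (N : ℝ) * ε N) atTop (𝓝 0)) :
    ∃ v : ℝ, D.stochasticValue P = (v : EReal) ∧
      (∀ᵐ ω ∂μ, Tendsto (fun N : ℕ => D.droValue (ε N) (fun i : Fin N => ξhat i ω))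
        atTop (𝓝 (v : EReal))) ∧
      -- linearized representation
      ((∃ lamBar, D.IsDualBound lamBar) ∧
        ∀ lamBar, D.IsDualBound lamBar →
          ∀ᵐ ω ∂μ, Tendsto (fun N : ℕ =>
              D.linearizedRelaxedValue lamBar (ε N) (fun i : Fin N => ξhat i ω))
            atTop (𝓝 (v : EReal))) ∧
      -- penalty representation
      (∀ T₀, D.FixedRecourse T₀ →
        (∃ ρ₀ > 0, ∀ ρ ≥ ρ₀, D.IsExactPenalty T₀ ρ) ∧
        ∀ ρ > 0, D.IsExactPenalty T₀ ρ →
          ∀ᵐ ω ∂μ, Tendsto (fun N : ℕ =>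
              D.penaltyRelaxedValue T₀ ρ (ε N) (fun i : Fin N => ξhat i ω))
            atTop (𝓝 (v : EReal))) := by
  obtain ⟨v, hv⟩ := exists_stochasticValue_eq_coe hP hA1 hA2
  -- For `N ≥ 1`, `0 ≤ ε N ≤ N * ε N`.
  have hε' : Tendsto ε atTop (𝓝 0) := by
    refine squeeze_zero' (Eventually.of_forall hε0) ?_ hε
    filter_upwards [eventually_ge_atTop 1] with N hN
    have : (1 : ℝ) ≤ N := by exact_mod_cast hN
    nlinarith [hε0 N]
  have hemp := ae_tendsto_empirical hmeas hindep hlaw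
  refine ⟨v, hv, ?_, ⟨exists_isDualBound hA1, fun lamBar hbar => ?_⟩,
    fun T₀ hfix => ⟨exists_isExactPenalty hA1 hA2 hfix, fun ρ _ hρ => ?_⟩⟩
  · filter_upwards [hemp] with ω hω
    refine tendsto_of_sampleAverage_bounds hA1 hA2 hP hv
      (fun N hN => empirical_mem_stdSimplex hN _) hω hε'
      (fun N hN => stochasticValue_le_droValue hN (hε0 N) _) fun x hx δ hδ => ?_
    obtain ⟨K, hK⟩ := exists_droValue_le hx
    exact ⟨K, fun N hN => (hK hN _ _).trans (EReal.coe_le_coe_iff.2 (by linarith))⟩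
  · filter_upwards [hemp] with ω hω
    refine tendsto_of_sampleAverage_bounds hA1 hA2 hP hv
      (fun N hN => empirical_mem_stdSimplex hN _) hω hε'
      (fun N hN => stochasticValue_le_reformValue (hε0 N) fun x hx i =>
        exists_mem_linearizedSet hA1 hA2 hbar hx _) fun x hx δ hδ => ?_
    -- The slope depends on `x` and `δ` but not on `N` or the sample, so it can serve as the
    -- constant `K`.
    obtain ⟨α, hα, h⟩ := exists_common_slope (D := D) (g := D.linearizedObjective x)
      (τ := fun z => z.2.2.2) (S := D.linearizedSet D.XiRelaxed lamBar)
      (fun ξ z hz => hz.2.2.2.1) (exists_linearized_slope hA2 hbar hx hδ)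
    exact ⟨α, fun N hN => reformValue_le hN hx hα fun i z hz => h _ z hz⟩
  · filter_upwards [hemp] with ω hω
    refine tendsto_of_sampleAverage_bounds hA1 hA2 hP hv
      (fun N hN => empirical_mem_stdSimplex hN _) hω hε'
      (fun N hN => stochasticValue_le_reformValue (hε0 N) fun x hx i =>
        exists_mem_penaltySet hA1 hA2 hfix hρ hx _) fun x hx δ hδ => ?_
    obtain ⟨α, hα, h⟩ := exists_common_slope (D := D) (g := D.penaltyObjective ρ x)
      (τ := fun z => z.2.2.2) (S := D.penaltySet D.XiRelaxed T₀ ρ)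
      (fun ξ z hz => hz.2.2.2.1) (exists_penalty_representation_slope hA1 hA2 hfix hρ hx hδ)
    exact ⟨α, fun N hN => reformValue_le hN hx hα fun i z hz => h _ z hz⟩
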